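/- Let $d,m\ge 1$, let $1<p_1,\dots,p_m<\infty$ and $1<p<\infty$ satisfy $1/p=\sum_{i=1}^m 1/p_i$, and let $f_i\in W^{1,p_i}(\mathbb{R}^d)$ be real-valued for $i=1,\dots,m$. Let $$\mathscr{M}_{\mathcal{R}}(\vec f)(x)=\sup_{R\ni x,\ R\in\mathcal{R}}\ \prod_{i=1}^m\frac{1}{|R|}\int_R|f_i(y)|\,dy\in[0,\infty],\qquad x\in\mathbb{R}^d,$$ where $\mathcal{R}$ is the family of all open rectangles in $\mathbb{R}^d$ with sides parallel to the coordinate axes. For $E\subset\mathbb{R}^d$, the Sobolev $p$-capacity is $$C_p(E)=\inf\int_{\mathbb{R}^d}\big(|u(y)|^p+|\nabla u(y)|^p\big)\,dy,$$ the infimum being over all $u\in W^{1,p}(\mathbb{R}^d)$ with $u\ge 1$ (almost everywhere) on a neighbourhood of $E$, and $C_p(E)=\infty$ if there is no such $u$. Then $\mathscr{M}_{\mathcal{R}}(\vec f)$ is $p$-quasicontinuous: for every $\varepsilon>0$ there is a set $F\subset\mathbb{R}^d$ with $C_p(F)<\varepsilon$ such that the restriction of $\mathscr{M}_{\mathcal{R}}(\vec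 f)$ to $\mathbb{R}^d\setminus F$ is continuous and finite. -/

import Mathlib

open MeasureTheory
open scoped ENNReal

/-- The open rectangle `∏ⱼ (aⱼ, bⱼ)` in `ℝ^d` with sides parallel to the coordinate axes. -/
def openRect {d : ℕ} (a b : Fin d → ℝ) : Set (EuclideanSpace ℝ (Fin d)) :=
  {y | ∀ j, a j < y j ∧ y j < b j}

/-- The multilinear strong maximal function: the supremum, over all (nondegenerate) open
axis-parallel rectangles `R` containing `x`, of `∏ᵢ |R|⁻¹ ∫_R |fᵢ|`. Its values lie in
`[0, ∞]`. -/
noncomputable def strongMaximal {d m : ℕ} (f : Fin m → EuclideanSpace ℝ (Fin d) → ℝ)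
    (x : EuclideanSpace ℝ (Fin d)) : ℝ≥0∞ :=
  ⨆ (a : Fin d → ℝ) (b : Fin d → ℝ) (_ : ∀ j, a j < b j) (_ : x ∈ openRect a b),
    ∏ i, (volume (openRect a b))⁻¹ * ∫⁻ y in openRect a b, ‖f i y‖ₑ

/-- `g` is the weak gradient of `f` on `ℝ^d`:
`∫ f ∂ⱼφ = - ∫ gⱼ φ` for every test function `φ ∈ C_c^∞(ℝ^d)` and every coordinate `j`. -/
def IsWeakGradient {d : ℕ} (f : EuclideanSpace ℝ (Fin d) → ℝ)
    (g : EuclideanSpace ℝ (Fin d) → EuclideanSpace ℝ (Fin d)) : Prop :=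
  LocallyIntegrable f ∧ LocallyIntegrable g ∧
    ∀ φ : EuclideanSpace ℝ (Fin d) → ℝ, ContDiff ℝ (⊤ : ℕ∞) φ → HasCompactSupport φ →
      ∀ j : Fin d,
        ∫ x, f x * fderiv ℝ φ x (EuclideanSpace.single j 1) = - ∫ x, g x j * φ x

/-- `f ∈ W^{1,p}(ℝ^d)` with weak gradient `g`: both `f` and `g` are in `L^p`. -/
def SobolevPair {d : ℕ} (p : ℝ) (f : EuclideanSpace ℝ (Fin d) → ℝ)
    (g : EuclideanSpace ℝ (Fin d) → EuclideanSpace ℝ (Fin d)) : Prop :=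
  IsWeakGradient f g ∧ MemLp f (ENNReal.ofReal p) ∧ MemLp g (ENNReal.ofReal p)

/-- `f ∈ W^{1,p}(ℝ^d)`. -/
def MemSobolev {d : ℕ} (p : ℝ) (f : EuclideanSpace ℝ (Fin d) → ℝ) : Prop :=
  ∃ g, SobolevPair p f g

/-- The Sobolev `p`-capacity of `E`: the infimum of `∫ (|u|^p + |∇u|^p)` over the
`u ∈ W^{1,p}(ℝ^d)` with `u ≥ 1` (almost everywhere, as `u` is a Sobolev function) on a
neighbourhood of `E`; it is `∞` if there is no such `u`. -/
noncomputable def sobolevCapacity {d : ℕ} (p : ℝ) (E : Set (EuclideanSpace ℝ (Fin d))) : ℝ≥0∞ :=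
  ⨅ (u : EuclideanSpace ℝ (Fin d) → ℝ)
    (g : EuclideanSpace ℝ (Fin d) → EuclideanSpace ℝ (Fin d))
    (_ : SobolevPair p u g)
    (_ : ∃ U, IsOpen U ∧ E ⊆ U ∧ ∀ᵐ y ∂(volume.restrict U), 1 ≤ u y),
    ∫⁻ y, (‖u y‖ₑ ^ p + ‖g y‖ₑ ^ p)

/-- A `[0, ∞]`-valued function `F` on `ℝ^d` is `p`-quasicontinuous: for every `ε > 0` there is a
set `A` with `C_p(A) < ε` such that the restriction of `F` to the complement of `A` is continuous
and finite. -/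
def IsQuasicontinuous {d : ℕ} (p : ℝ) (F : EuclideanSpace ℝ (Fin d) → ℝ≥0∞) : Prop :=
  ∀ ε : ℝ≥0∞, 0 < ε → ∃ A : Set (EuclideanSpace ℝ (Fin d)),
    sobolevCapacity p A < ε ∧ ContinuousOn F Aᶜ ∧ ∀ x ∈ Aᶜ, F x ≠ ⊤

open Set Filter Topology Metric
open scoped NNReal

/-! Each $f_i$ is approximated by bounded Lipschitz functions $g_n$, uniformly in the sense of
rectangle averages, off a set of small capacity. Write $M$ for the strong maximal function of one
function.

Capacity estimate: $M$ is sublinear and commutes with translations, so where $Mg$ has a derivative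
along the $j$-th axis, its size is at most $M(\partial_j g)$. By the strong maximal theorem in
$L^q$, with $p\le q$, the power $(Mg)^{q/p}$ lies in $W^{1,p}$ with norm controlled by that of $g$
in $W^{1,q}$; it is a test function for the capacity of $\{Mg>1\}$
(`exists_sobolevPair_of_uniformC1`). The relation between the exponents enters through $p\le p_i$.

Approximation: mollification gives $g_n\to f_i$ in $W^{1,p_i}$ as fast as needed. The estimate for
$2^n(g_{n+1}-g_n)$ yields open sets $U_n$ outside which all rectangle averages of $|g_{n+1}-g_n|$
are at most $2^{-n}$. Telescoping bounds those of $|f_i-g_n|$ by $2\cdot 2^{-n}$ off $\bigcup_n U_n$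
(`SobolevPair.exists_quasiuniform_approximation`), and `sobolevCapacity_iUnion_le` bounds the
capacity of the union.

Continuity: for $x,x'$ off the exceptional set, a rectangle $R\ni x$ is compared with $R+x'-x\ni
x'$. The averages of $|g_n|$ differ by at most $L|x'-x|$, hence those of $|f_i|$ by little more, and
so do the products and their suprema (`strongMaximal_ne_top_and_continuousOn`). -/

/-! ### The Hardy–Littlewood maximal inequality on the line. -/

lemma lintegral_Ioi_layer (F : ℝ≥0∞) {r : ℝ} (hr : 0 < r) :
    ∫⁻ t in Ioi (0 : ℝ), (if ENNReal.ofReal t < F then ENNReal.ofReal (r * t ^ (r - 1)) else 0)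
      = F ^ r := by
  have key : ∀ x : ℝ≥0, ∫⁻ t in Ioi (0 : ℝ),
      (if ENNReal.ofReal t < x then ENNReal.ofReal (r * t ^ (r - 1)) else 0) = (x : ℝ≥0∞) ^ r := by
    intro x
    have h := lintegral_rpow_eq_lintegral_meas_lt_mul (Measure.dirac ())
      (f := fun _ => (x : ℝ)) (ae_of_all _ fun _ => x.2) measurable_const.aemeasurable hr
    simp only [lintegral_const, measure_univ, mul_one] at h
    rw [← ENNReal.ofReal_coe_nnreal, ENNReal.ofReal_rpow_of_nonneg x.coe_nonneg hr.le, h,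
      ← lintegral_const_mul' _ _ ENNReal.ofReal_ne_top]
    refine setLIntegral_congr_fun measurableSet_Ioi fun t ht => ?_
    have : ENNReal.ofReal t < ENNReal.ofReal x ↔ t < x := by
      rw [ENNReal.ofReal_lt_ofReal_iff_of_nonneg (le_of_lt ht)]
    simp only [this]
    by_cases h' : t < x
    · simp [h', ENNReal.ofReal_mul hr.le]
    · simp [h']
  induction F with
  | coe x => exact key x
  | top =>
    rw [ENNReal.top_rpow_of_pos hr, eq_top_iff]
    refine ENNReal.le_of_forall_nnreal_lt fun y _ => ?_
    calc (y : ℝ≥0∞) = ((y ^ (1 / r) : ℝ≥0) : ℝ≥0∞) ^ r := by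
          rw [← ENNReal.coe_rpow_of_nonneg _ hr.le, ← NNReal.rpow_mul, one_div,
            inv_mul_cancel₀ hr.ne', NNReal.rpow_one]
      _ = _ := (key _).symm
      _ ≤ _ := by
        refine lintegral_mono fun t => ?_
        dsimp only
        split_ifs <;> simp_all

/-- The centred maximal function on the line, over positive rational radii. -/
noncomputable def centredMaximal (h : ℝ → ℝ≥0∞) (s : ℝ) : ℝ≥0∞ :=
  ⨆ r : {r : ℚ // 0 < r}, (ENNReal.ofReal (r : ℚ))⁻¹ * ∫⁻ t in closedBall s (r : ℚ), h t

/-- Vitali covering: disjoint balls whose fourfold enlargements cover the level set. An enlarged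
ball has length $8r$, and $cr$ is at most the integral of $h$ over the original ball. -/
lemma volume_lt_centredMaximal_le (h : ℝ → ℝ≥0∞) {c : ℝ≥0∞} (hc : c ≠ 0) (hc' : c ≠ ⊤) :
    volume {s | c < centredMaximal h s} ≤ 8 * c⁻¹ * ∫⁻ t, h t := by
  rcases eq_or_ne (∫⁻ t, h t) ⊤ with htop | htop
  · rw [htop, ENNReal.mul_top]
    · exact le_top
    · simp [hc']
  -- The radius is chosen for every $s$, with the dummy value $0$ off the level set.
  have H : ∀ s, ∃ r : ℝ, s ∈ {s | c < centredMaximal h s} →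
      0 < r ∧ c * ENNReal.ofReal r ≤ ∫⁻ t in closedBall s r, h t := by
    intro s
    by_cases hs : s ∈ {s | c < centredMaximal h s}
    · obtain ⟨r, hr⟩ := lt_iSup_iff.1 (show c < centredMaximal h s from hs)
      have hr0 : (0 : ℝ) < (r : ℚ) := by exact_mod_cast r.2
      refine ⟨(r : ℚ), fun _ => ⟨hr0, ?_⟩⟩
      rw [mul_comm, ← div_eq_mul_inv] at hr
      exact ((ENNReal.lt_div_iff_mul_lt (.inl (by simpa using hr0))
        (.inl ENNReal.ofReal_ne_top)).1 hr).le
    · exact ⟨0, fun h => (hs h).elim⟩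
  choose r hr using H
  have hbound : ∀ s ∈ {s | c < centredMaximal h s}, r s ≤ (c⁻¹ * ∫⁻ t, h t).toReal := by
    intro s hs
    rw [← ENNReal.ofReal_le_iff_le_toReal (ENNReal.mul_ne_top (by simpa using hc) htop),
      ← ENNReal.mul_le_iff_le_inv hc hc']
    exact (hr s hs).2.trans (setLIntegral_le_lintegral _ _)
  obtain ⟨u, hu, hdisj, hcov⟩ := Vitali.exists_disjoint_subfamily_covering_enlargement_closedBall
    {s | c < centredMaximal h s} id r _ hbound 4 (by norm_num)
  have hcount : u.Countable := by
    refine hdisj.countable_of_nonempty_interior fun s hs => ?_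
    exact ⟨s, ball_subset_interior_closedBall (mem_ball_self (hr s (hu hs)).1)⟩
  have hsub : {s | c < centredMaximal h s} ⊆ ⋃ s ∈ u, closedBall s (4 * r s) := by
    intro s hs
    obtain ⟨b, hb, hsb⟩ := hcov s hs
    exact mem_biUnion hb (hsb (mem_closedBall_self (hr s hs).1.le))
  calc volume {s | c < centredMaximal h s} ≤ ∑' s : u, volume (closedBall (s : ℝ) (4 * r s)) :=
        (measure_mono hsub).trans (measure_biUnion_le _ hcount _)
    _ ≤ ∑' s : u, 8 * c⁻¹ * ∫⁻ t in closedBall (s : ℝ) (r s), h t := by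
        refine ENNReal.tsum_le_tsum fun s => ?_
        rw [Real.volume_closedBall, show 2 * (4 * r s) = 8 * r s by ring,
          ENNReal.ofReal_mul (by norm_num), mul_assoc]
        simp only [ENNReal.ofReal_ofNat]
        gcongr
        rw [← ENNReal.mul_le_iff_le_inv hc hc']
        exact (hr s (hu s.2)).2
    _ = 8 * c⁻¹ * ∑' s : u, ∫⁻ t in closedBall (s : ℝ) (r s), h t := ENNReal.tsum_mul_left
    _ = 8 * c⁻¹ * ∫⁻ t in ⋃ s ∈ u, closedBall (s : ℝ) (r s), h t := by
        congr 1
        exact (lintegral_biUnion hcount (fun _ _ => measurableSet_closedBall) hdisj _).symm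
    _ ≤ _ := by
        refine mul_le_mul_right ?_ _
        exact setLIntegral_le_lintegral _ _

/-- The part of $h$ below level $c$ contributes at most $2c$, since the ball has length $2r$ but the
average is normalised by $r$. -/
lemma centredMaximal_le_add (h : ℝ → ℝ≥0∞) (c : ℝ≥0∞) (s : ℝ) :
    centredMaximal h s ≤ 2 * c + centredMaximal (fun t => if c < h t then h t else 0) s := by
  refine iSup_le fun r => ?_
  have hr0 : (0 : ℝ) < (r : ℚ) := by exact_mod_cast r.2
  have hpos : ENNReal.ofReal (r : ℚ) ≠ 0 := by simpa using hr0
  calc (ENNReal.ofReal (r : ℚ))⁻¹ * ∫⁻ t in closedBall s (r : ℚ), h t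
      ≤ (ENNReal.ofReal (r : ℚ))⁻¹ * ∫⁻ t in closedBall s (r : ℚ),
          (c + if c < h t then h t else 0) := by
        gcongr with t
        split_ifs with h'
        · exact le_add_self
        · simpa using h'
    _ = (ENNReal.ofReal (r : ℚ))⁻¹ * (c * (2 * ENNReal.ofReal (r : ℚ))) +
        (ENNReal.ofReal (r : ℚ))⁻¹ * ∫⁻ t in closedBall s (r : ℚ),
          (if c < h t then h t else 0) := by
        rw [lintegral_add_left measurable_const, mul_add, setLIntegral_const,
          Real.volume_closedBall, ENNReal.ofReal_mul (by norm_num)]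
        simp
    _ = 2 * c + (ENNReal.ofReal (r : ℚ))⁻¹ * ∫⁻ t in closedBall s (r : ℚ),
          (if c < h t then h t else 0) := by
        congr 1
        rw [mul_comm, mul_assoc, mul_assoc, ENNReal.mul_inv_cancel hpos ENNReal.ofReal_ne_top]
        ring
    _ ≤ _ := by
        gcongr
        exact le_iSup (fun r : {r : ℚ // 0 < r} => (ENNReal.ofReal (r : ℚ))⁻¹ *
          ∫⁻ t in closedBall s (r : ℚ), (if c < h t then h t else 0)) r

/-- Rational radii make the supremum countable. The parameter lets the result apply to maximal
functions along coordinate axes. -/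
lemma measurable_centredMaximal {α : Type*} [MeasurableSpace α] (H : α → ℝ → ℝ≥0∞)
    (hH : Measurable (fun z : α × ℝ => H z.1 z.2)) {s : α → ℝ} (hs : Measurable s) :
    Measurable fun x => centredMaximal (H x) (s x) := by
  unfold centredMaximal
  refine Measurable.iSup fun r => Measurable.const_mul ?_ _
  have hset : MeasurableSet {z : α × ℝ | z.2 ∈ closedBall (s z.1) (r : ℚ)} := by
    simp only [mem_closedBall]
    exact measurableSet_le (measurable_snd.dist (hs.comp measurable_fst)) measurable_const
  have := (hH.indicator hset).lintegral_prod_right' (ν := volume)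
  convert this using 2 with x
  rw [← lintegral_indicator measurableSet_closedBall]
  refine lintegral_congr fun t => ?_
  simp [indicator]

/-- The Hardy–Littlewood maximal inequality on the line. -/
lemma lintegral_centredMaximal_rpow_le {q : ℝ} (hq : 1 < q) :
    ∃ C : ℝ≥0∞, C ≠ ⊤ ∧ ∀ h : ℝ → ℝ≥0∞, Measurable h →
      ∫⁻ s, centredMaximal h s ^ q ≤ C * ∫⁻ s, h s ^ q := by
  -- The factor $3^q$ undoes the $1/3$ in the level sets below; $8q/(q-1)$ is the weak-type constant
  -- $8$ times the factor from integrating $qt^{q-2}$ over $0<t<h(s)$.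
  refine ⟨ENNReal.ofReal (3 ^ q * (8 * q / (q - 1))), ENNReal.ofReal_ne_top, fun h hh => ?_⟩
  have hq0 : 0 < q := by linarith
  have hq1 : 0 < q - 1 := by linarith
  have hM : Measurable (centredMaximal h) :=
    measurable_centredMaximal (fun _ => h) (hh.comp measurable_snd) measurable_id
  -- If the maximal function of $h$ truncated to $\{h>t\}$ is at most $t$ at $s$, then that of $h$
  -- is at most $2t+t=3t$; otherwise the weak-type bound applies to the truncation.
  have hlevel : ∀ t : ℝ, 0 < t → volume {s | ENNReal.ofReal t < 3⁻¹ * centredMaximal h s} ≤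
      8 * (ENNReal.ofReal t)⁻¹ * ∫⁻ s, if ENNReal.ofReal t < h s then h s else 0 := by
    intro t ht
    refine (measure_mono fun s hs => ?_).trans
      (volume_lt_centredMaximal_le _ (by simpa using ht) ENNReal.ofReal_ne_top)
    simp only [mem_ofPred_eq] at hs ⊢
    by_contra! hcon
    have h1 := (centredMaximal_le_add h (ENNReal.ofReal t) s).trans (add_le_add_right hcon _)
    have h2 : 3⁻¹ * centredMaximal h s ≤ ENNReal.ofReal t := by
      rw [mul_comm, ← div_eq_mul_inv]
      refine ENNReal.div_le_of_le_mul (h1.trans (le_of_eq ?_))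
      ring
    exact absurd hs (not_lt.2 h2)
  have e1 : ∫⁻ s, (3⁻¹ * centredMaximal h s) ^ q =
      ∫⁻ t in Ioi (0 : ℝ), ENNReal.ofReal (q * t ^ (q - 1)) *
        volume {s | ENNReal.ofReal t < 3⁻¹ * centredMaximal h s} := by
    calc _ = ∫⁻ s, ∫⁻ t in Ioi (0 : ℝ), (if ENNReal.ofReal t < 3⁻¹ * centredMaximal h s then
            ENNReal.ofReal (q * t ^ (q - 1)) else 0) :=
          lintegral_congr fun s => (lintegral_Ioi_layer _ hq0).symm
      _ = ∫⁻ t in Ioi (0 : ℝ), ∫⁻ s, (if ENNReal.ofReal t < 3⁻¹ * centredMaximal h s then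
            ENNReal.ofReal (q * t ^ (q - 1)) else 0) := by
          refine lintegral_lintegral_swap (Measurable.aemeasurable ?_)
          refine Measurable.ite (measurableSet_lt ?_ ?_) ?_ measurable_const <;> fun_prop
      _ = _ := by
          refine lintegral_congr fun t => ?_
          have hs : MeasurableSet {s | ENNReal.ofReal t < 3⁻¹ * centredMaximal h s} :=
            measurableSet_lt measurable_const (hM.const_mul _)
          rw [← setLIntegral_const, ← lintegral_indicator hs]
          simp [indicator]
  have e2 : ∫⁻ t in Ioi (0 : ℝ), ENNReal.ofReal (q * t ^ (q - 1)) *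
        (8 * (ENNReal.ofReal t)⁻¹ * ∫⁻ s, if ENNReal.ofReal t < h s then h s else 0) =
      ENNReal.ofReal (8 * q / (q - 1)) * ∫⁻ s, h s ^ q := by
    calc _ = ∫⁻ t in Ioi (0 : ℝ), ∫⁻ s, ENNReal.ofReal (8 * q / (q - 1)) * (h s *
            if ENNReal.ofReal t < h s then ENNReal.ofReal ((q - 1) * t ^ (q - 1 - 1)) else 0) := by
          refine setLIntegral_congr_fun measurableSet_Ioi fun t (ht : 0 < t) => ?_
          rw [← mul_assoc, ← lintegral_const_mul _
            (Measurable.ite (measurableSet_lt measurable_const hh) hh measurable_const)]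
          refine lintegral_congr fun s => ?_
          split_ifs
          · have : ENNReal.ofReal (q * t ^ (q - 1)) * (8 * (ENNReal.ofReal t)⁻¹) =
                ENNReal.ofReal (8 * q / (q - 1)) * ENNReal.ofReal ((q - 1) * t ^ (q - 1 - 1)) := by
              rw [← ENNReal.ofReal_inv_of_pos ht, ← ENNReal.ofReal_mul (by positivity),
                ← ENNReal.ofReal_ofNat, ← ENNReal.ofReal_mul (by norm_num),
                ← ENNReal.ofReal_mul (by positivity), Real.rpow_sub_one ht.ne' (q - 1)]
              congr 1
              field_simp
            rw [this]; ring
          · simp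
      _ = ∫⁻ s, ∫⁻ t in Ioi (0 : ℝ), ENNReal.ofReal (8 * q / (q - 1)) * (h s *
            if ENNReal.ofReal t < h s then ENNReal.ofReal ((q - 1) * t ^ (q - 1 - 1)) else 0) := by
          refine lintegral_lintegral_swap (Measurable.aemeasurable ?_)
          refine Measurable.const_mul (Measurable.mul (by fun_prop) ?_) _
          refine Measurable.ite (measurableSet_lt ?_ ?_) ?_ measurable_const <;> fun_prop
      _ = ∫⁻ s, ENNReal.ofReal (8 * q / (q - 1)) * h s ^ q := by
          refine lintegral_congr fun s => ?_
          have m1 : Measurable fun t : ℝ => if ENNReal.ofReal t < h s then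
              ENNReal.ofReal ((q - 1) * t ^ (q - 1 - 1)) else 0 := by
            refine Measurable.ite (measurableSet_lt ?_ ?_) ?_ measurable_const <;> fun_prop
          rw [lintegral_const_mul _ (m1.const_mul _), lintegral_const_mul _ m1,
            lintegral_Ioi_layer _ hq1]
          congr 1
          nth_rewrite 1 [← ENNReal.rpow_one (h s)]
          rw [← ENNReal.rpow_add_of_nonneg _ _ zero_le_one hq1.le]
          congr 1; ring
      _ = _ := lintegral_const_mul _ (hh.pow_const q)
  have e3 : ∫⁻ s, (3⁻¹ * centredMaximal h s) ^ q = (3 ^ q)⁻¹ * ∫⁻ s, centredMaximal h s ^ q := by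
    rw [← lintegral_const_mul _ (hM.pow_const q)]
    refine lintegral_congr fun s => ?_
    rw [ENNReal.mul_rpow_of_nonneg _ _ hq0.le, ENNReal.inv_rpow]
  have e4 : (3 ^ q)⁻¹ * ∫⁻ s, centredMaximal h s ^ q ≤
      ENNReal.ofReal (8 * q / (q - 1)) * ∫⁻ s, h s ^ q := by
    rw [← e3, e1, ← e2]
    refine setLIntegral_mono_ae' measurableSet_Ioi (ae_of_all _ fun t ht => ?_)
    gcongr
    exact hlevel t ht
  rw [ENNReal.ofReal_mul (by positivity), ← ENNReal.ofReal_rpow_of_pos (by norm_num),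
    ENNReal.ofReal_ofNat, mul_assoc]
  have h3 : (3 : ℝ≥0∞) ^ q ≠ 0 := by simp
  have h3' : (3 : ℝ≥0∞) ^ q ≠ ⊤ := ENNReal.rpow_ne_top_of_nonneg hq0.le (by simp)
  calc _ = 3 ^ q * ((3 ^ q)⁻¹ * ∫⁻ s, centredMaximal h s ^ q) := by
        rw [← mul_assoc, ENNReal.mul_inv_cancel h3 h3', one_mul]
    _ ≤ _ := by gcongr

/-- A ball centred at $s$ with rational radius between $b-a$ and $2(b-a)$ covers the interval; this
passes from uncentred to centred averages. -/
lemma setLIntegral_Ioo_le_centredMaximal (k : ℝ → ℝ≥0∞) {a b s : ℝ} (hs : s ∈ Ioo a b) :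
    ∫⁻ t in Ioo a b, k t ≤ 2 * ENNReal.ofReal (b - a) * centredMaximal k s := by
  have hab : 0 < b - a := by linarith [hs.1, hs.2]
  obtain ⟨r, hr1, hr2⟩ := exists_rat_btwn (show b - a < 2 * (b - a) by linarith)
  have hr0 : (0 : ℝ) < r := hab.trans hr1
  have hpos : ENNReal.ofReal r ≠ 0 := by simpa using hr0
  have hsub : Ioo a b ⊆ closedBall s (r : ℝ) := by
    intro t ht
    rw [mem_closedBall, Real.dist_eq, abs_le]
    constructor <;> linarith [ht.1, ht.2, hs.1, hs.2]
  calc ∫⁻ t in Ioo a b, k t ≤ ∫⁻ t in closedBall s (r : ℝ), k t := lintegral_mono_set hsub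
    _ = ENNReal.ofReal r * ((ENNReal.ofReal r)⁻¹ * ∫⁻ t in closedBall s (r : ℝ), k t) := by
      rw [← mul_assoc, ENNReal.mul_inv_cancel hpos ENNReal.ofReal_ne_top, one_mul]
    _ ≤ ENNReal.ofReal r * centredMaximal k s := by
      gcongr
      exact le_iSup (fun r : {r : ℚ // 0 < r} => (ENNReal.ofReal (r : ℚ))⁻¹ *
        ∫⁻ t in closedBall s (r : ℚ), k t) ⟨r, by exact_mod_cast hr0⟩
    _ ≤ _ := by
      gcongr
      rw [← ENNReal.ofReal_ofNat, ← ENNReal.ofReal_mul (by norm_num)]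
      exact ENNReal.ofReal_le_ofReal hr2.le

/-! ### The strong maximal theorem by iteration over the coordinates. -/

section Pi

variable {ι : Type*} [DecidableEq ι]

/-- The centred maximal function in the direction of the `j`-th axis. -/
noncomputable def axisMaximal (j : ι) (h : (ι → ℝ) → ℝ≥0∞) (x : ι → ℝ) : ℝ≥0∞ :=
  centredMaximal (fun t => h (Function.update x j t)) (x j)

lemma measurable_axisMaximal (j : ι) {h : (ι → ℝ) → ℝ≥0∞} (hh : Measurable h) :
    Measurable (axisMaximal j h) :=
  measurable_centredMaximal (fun x t => h (Function.update x j t))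
    (hh.comp measurable_update') (measurable_pi_apply j)

lemma measurable_foldr_axisMaximal (l : List ι) {h : (ι → ℝ) → ℝ≥0∞} (hh : Measurable h) :
    Measurable (l.foldr axisMaximal h) := by
  induction l with
  | nil => exact hh
  | cons j l ih => exact measurable_axisMaximal j ih

/-- By Tonelli, each coordinate contributes one use of the one-dimensional inequality on the lines
parallel to its axis. -/
lemma lintegral_foldr_axisMaximal_rpow_le [Fintype ι] {q : ℝ} (hq : 1 < q) (l : List ι) :
    ∃ C : ℝ≥0∞, C ≠ ⊤ ∧ ∀ h : (ι → ℝ) → ℝ≥0∞, Measurable h →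
      ∫⁻ x, l.foldr axisMaximal h x ^ q ≤ C * ∫⁻ x, h x ^ q := by
  obtain ⟨C, hC, H⟩ := lintegral_centredMaximal_rpow_le hq
  induction l with
  | nil => exact ⟨1, by simp, fun h _ => by simp⟩
  | cons j l ih =>
    obtain ⟨D, hD, ih⟩ := ih
    refine ⟨C * D, ENNReal.mul_ne_top hC hD, fun h hh => ?_⟩
    have hk := measurable_foldr_axisMaximal l hh
    rw [mul_assoc]
    refine le_trans ?_ (mul_le_mul_right (ih h hh) _)
    rw [← lintegral_const_mul _ (hk.pow_const q), List.foldr_cons]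
    refine lintegral_le_of_lmarginal_le {j} ((measurable_axisMaximal j hk).pow_const q)
      ((hk.pow_const q).const_mul _) fun x => ?_
    rw [lmarginal_singleton, lmarginal_singleton]
    simp only [axisMaximal, Function.update_idem, Function.update_self]
    have hu : Measurable fun t => l.foldr axisMaximal h (Function.update x j t) :=
      hk.comp (measurable_update x)
    rw [lintegral_const_mul _ (hu.pow_const q)]
    exact H _ hu

/-- The coordinates are integrated out one at a time. As the list has no repetition, changing the
head coordinate leaves the membership conditions for the tail intact. -/
lemma lmarginal_Ioo_le_foldr_axisMaximal {h : (ι → ℝ) → ℝ≥0∞} (hh : Measurable h)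
    (a b : ι → ℝ) (l : List ι) (hl : l.Nodup) (x : ι → ℝ) (hx : ∀ j ∈ l, x j ∈ Ioo (a j) (b j)) :
    (∫⋯∫⁻_l.toFinset, h ∂(fun j => volume.restrict (Ioo (a j) (b j)))) x ≤
      (∏ j ∈ l.toFinset, 2 * ENNReal.ofReal (b j - a j)) * l.foldr axisMaximal h x := by
  induction l generalizing x with
  | nil => simp
  | cons i l ih =>
    obtain ⟨hi, hl⟩ := List.nodup_cons.1 hl
    have hi' : i ∉ l.toFinset := by simpa using hi
    have hk := measurable_foldr_axisMaximal l hh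
    rw [List.toFinset_cons, lmarginal_insert _ hh hi', Finset.prod_insert hi', List.foldr_cons]
    calc _ ≤ ∫⁻ t in Ioo (a i) (b i), (∏ j ∈ l.toFinset, 2 * ENNReal.ofReal (b j - a j)) *
          l.foldr axisMaximal h (Function.update x i t) := by
          refine lintegral_mono fun t => ih hl _ fun j hj => ?_
          rw [Function.update_of_ne (by rintro rfl; exact hi hj)]
          exact hx j (List.mem_cons_of_mem _ hj)
      _ = (∏ j ∈ l.toFinset, 2 * ENNReal.ofReal (b j - a j)) * ∫⁻ t in Ioo (a i) (b i),
          l.foldr axisMaximal h (Function.update x i t) :=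
          lintegral_const_mul _ (hk.comp (measurable_update x))
      _ ≤ (∏ j ∈ l.toFinset, 2 * ENNReal.ofReal (b j - a j)) *
          (2 * ENNReal.ofReal (b i - a i) * axisMaximal i (l.foldr axisMaximal h) x) := by
          gcongr
          exact setLIntegral_Ioo_le_centredMaximal _ (hx i List.mem_cons_self)
      _ = _ := by ring

end Pi

section Rect

variable {d : ℕ}

/-- The mean value of `h` over the open rectangle with corners `a` and `b`. -/
noncomputable def rectAverage (a b : Fin d → ℝ) (h : EuclideanSpace ℝ (Fin d) → ℝ≥0∞) : ℝ≥0∞ :=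
  (volume (openRect a b))⁻¹ * ∫⁻ y in openRect a b, h y

/-- The strong maximal function of one function with values in `[0, ∞]`. -/
noncomputable def rectMaximal (h : EuclideanSpace ℝ (Fin d) → ℝ≥0∞)
    (x : EuclideanSpace ℝ (Fin d)) : ℝ≥0∞ :=
  ⨆ (a : Fin d → ℝ) (b : Fin d → ℝ) (_ : ∀ j, a j < b j) (_ : x ∈ openRect a b),
    rectAverage a b h

lemma rectAverage_le_rectMaximal {a b : Fin d → ℝ} {x : EuclideanSpace ℝ (Fin d)}
    (hab : ∀ j, a j < b j)
    (hx : x ∈ openRect a b) (h : EuclideanSpace ℝ (Fin d) → ℝ≥0∞) :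
    rectAverage a b h ≤ rectMaximal h x :=
  le_iSup₂_of_le a b (le_iSup₂_of_le hab hx le_rfl)

lemma openRect_eq_preimage (a b : Fin d → ℝ) :
    openRect a b = WithLp.ofLp ⁻¹' (univ.pi fun j => Ioo (a j) (b j)) := by
  ext x
  simp [openRect]

lemma isOpen_openRect (a b : Fin d → ℝ) : IsOpen (openRect a b) := by
  rw [openRect_eq_preimage]
  exact (isOpen_set_pi finite_univ fun _ _ => isOpen_Ioo).preimage (PiLp.continuous_ofLp 2 _)

lemma volume_openRect (a b : Fin d → ℝ) :
    volume (openRect a b) = ∏ j, ENNReal.ofReal (b j - a j) := by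
  rw [openRect_eq_preimage, (PiLp.volume_preserving_ofLp (Fin d)).measure_preimage
    (MeasurableSet.univ_pi fun _ => measurableSet_Ioo).nullMeasurableSet, volume_pi_pi]
  simp

lemma volume_openRect_ne_zero {a b : Fin d → ℝ} (hab : ∀ j, a j < b j) :
    volume (openRect a b) ≠ 0 := by
  rw [volume_openRect, Finset.prod_ne_zero_iff]
  intro j _
  simpa using hab j

lemma volume_openRect_ne_top (a b : Fin d → ℝ) : volume (openRect a b) ≠ ⊤ := by
  rw [volume_openRect]
  exact ENNReal.prod_ne_top fun j _ => ENNReal.ofReal_ne_top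

lemma rectAverage_le_foldr_axisMaximal {h : EuclideanSpace ℝ (Fin d) → ℝ≥0∞} (hh : Measurable h)
    {a b : Fin d → ℝ}
    {x : EuclideanSpace ℝ (Fin d)} (hx : x ∈ openRect a b) :
    rectAverage a b h ≤ 2 ^ d *
      (Finset.univ.toList : List (Fin d)).foldr axisMaximal (h ∘ WithLp.toLp 2) x.ofLp := by
  have hh' : Measurable (h ∘ (WithLp.toLp 2 : (Fin d → ℝ) → EuclideanSpace ℝ (Fin d))) :=
    hh.comp (PiLp.volume_preserving_toLp (Fin d)).measurable
  have h1 : ∫⁻ y in openRect a b, h y =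
      ∫⁻ z, (h ∘ WithLp.toLp 2) z ∂(Measure.pi fun j => volume.restrict (Ioo (a j) (b j))) := by
    rw [← Measure.restrict_pi_pi, ← volume_pi, openRect_eq_preimage]
    exact ((PiLp.volume_preserving_ofLp (Fin d)).restrict_preimage
      (MeasurableSet.univ_pi fun _ => measurableSet_Ioo)).lintegral_comp hh'
  have h2 := lmarginal_Ioo_le_foldr_axisMaximal hh' a b Finset.univ.toList
    (Finset.nodup_toList _) x.ofLp (fun j _ => hx j)
  rw [Finset.toList_toFinset, ← lintegral_eq_lmarginal_univ, ← h1, Finset.prod_mul_distrib,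
    ← volume_openRect, Finset.prod_const, Finset.card_univ, Fintype.card_fin] at h2
  unfold rectAverage
  rw [mul_comm, ← div_eq_mul_inv]
  refine ENNReal.div_le_of_le_mul (h2.trans (le_of_eq ?_))
  ring

/-- The strong maximal theorem. -/
lemma lintegral_rectMaximal_rpow_le (d : ℕ) {q : ℝ} (hq : 1 < q) :
    ∃ C : ℝ≥0∞, C ≠ ⊤ ∧ ∀ h : EuclideanSpace ℝ (Fin d) → ℝ≥0∞, Measurable h →
      ∫⁻ x, rectMaximal h x ^ q ≤ C * ∫⁻ x, h x ^ q := by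
  have hq0 : 0 ≤ q := by linarith
  obtain ⟨C, hC, H⟩ := lintegral_foldr_axisMaximal_rpow_le hq (Finset.univ.toList : List (Fin d))
  -- Pointwise, $M$ is at most $2^d$ times the iterated axis maximal function: one factor $2$ per
  -- coordinate.
  refine ⟨(2 ^ d) ^ q * C, ENNReal.mul_ne_top (ENNReal.rpow_ne_top_of_nonneg hq0 (by simp)) hC,
    fun h hh => ?_⟩
  have hh' : Measurable (h ∘ (WithLp.toLp 2 : (Fin d → ℝ) → EuclideanSpace ℝ (Fin d))) :=
    hh.comp (PiLp.volume_preserving_toLp (Fin d)).measurable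
  have hm := (measurable_foldr_axisMaximal Finset.univ.toList hh').pow_const q
  calc ∫⁻ x, rectMaximal h x ^ q
      ≤ ∫⁻ x : EuclideanSpace ℝ (Fin d), (2 ^ d) ^ q * ((Finset.univ.toList : List (Fin d)).foldr
          axisMaximal (h ∘ WithLp.toLp 2) x.ofLp) ^ q := by
        refine lintegral_mono fun x => ?_
        rw [← ENNReal.mul_rpow_of_nonneg _ _ hq0]
        gcongr
        refine iSup₂_le fun a b => iSup₂_le fun _ hx => ?_
        exact rectAverage_le_foldr_axisMaximal hh hx
    _ = (2 ^ d) ^ q * ∫⁻ x, ((Finset.univ.toList : List (Fin d)).foldr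
          axisMaximal (h ∘ WithLp.toLp 2) x) ^ q := by
        rw [← (PiLp.volume_preserving_ofLp (Fin d)).lintegral_comp hm]
        exact lintegral_const_mul _ (hm.comp (PiLp.volume_preserving_ofLp (Fin d)).measurable)
    _ ≤ (2 ^ d) ^ q * (C * ∫⁻ x, (h ∘ WithLp.toLp 2) x ^ q) := by
        gcongr
        exact H _ hh'
    _ = _ := by
        rw [mul_assoc, ← (PiLp.volume_preserving_toLp (Fin d)).lintegral_comp (hh.pow_const q)]
        rfl

end Rect

/-! ### Sublinearity, translation invariance and measurability. -/

section RectAlgebra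

variable {d : ℕ}

lemma rectAverage_mono {a b : Fin d → ℝ} {h k : EuclideanSpace ℝ (Fin d) → ℝ≥0∞}
    (hk : ∀ y, h y ≤ k y) :
    rectAverage a b h ≤ rectAverage a b k :=
  mul_le_mul_right (lintegral_mono hk) _

lemma rectAverage_add {a b : Fin d → ℝ} {h : EuclideanSpace ℝ (Fin d) → ℝ≥0∞} (hh : AEMeasurable h)
    (k : EuclideanSpace ℝ (Fin d) → ℝ≥0∞) :
    rectAverage a b (fun y => h y + k y) = rectAverage a b h + rectAverage a b k := by
  unfold rectAverage
  rw [lintegral_add_left' hh.restrict, mul_add]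

lemma rectAverage_const {a b : Fin d → ℝ} (hab : ∀ j, a j < b j) (c : ℝ≥0∞) :
    rectAverage a b (fun _ => c) = c := by
  unfold rectAverage
  rw [setLIntegral_const, mul_comm, mul_assoc, ENNReal.mul_inv_cancel
    (volume_openRect_ne_zero hab) (volume_openRect_ne_top a b), mul_one]

lemma rectAverage_const_mul (a b : Fin d → ℝ) {c : ℝ≥0∞} (hc : c ≠ ⊤)
    (h : EuclideanSpace ℝ (Fin d) → ℝ≥0∞) :
    rectAverage a b (fun y => c * h y) = c * rectAverage a b h := by
  unfold rectAverage
  rw [lintegral_const_mul' _ _ hc]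
  ring

lemma mem_openRect_add {a b : Fin d → ℝ} {x : EuclideanSpace ℝ (Fin d)}
    (w : EuclideanSpace ℝ (Fin d)) :
    x + w ∈ openRect (fun j => a j + w j) (fun j => b j + w j) ↔ x ∈ openRect a b := by
  simp [openRect]

lemma rectAverage_translate (a b : Fin d → ℝ) (w : EuclideanSpace ℝ (Fin d))
    (h : EuclideanSpace ℝ (Fin d) → ℝ≥0∞) :
    rectAverage (fun j => a j + w j) (fun j => b j + w j) h =
      rectAverage a b (fun y => h (y + w)) := by
  have hpre : (fun y : EuclideanSpace ℝ (Fin d) => y + w) ⁻¹' openRect (fun j => a j + w j)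
    (fun j => b j + w j) =
      openRect a b := by
    ext y
    exact mem_openRect_add w
  unfold rectAverage
  have hm := measurePreserving_add_right (volume : Measure (EuclideanSpace ℝ (Fin d))) w
  have hs := (isOpen_openRect (fun j => a j + w j) (fun j => b j + w j)).measurableSet
  have h1 := hm.measure_preimage hs.nullMeasurableSet
  have h2 := hm.setLIntegral_comp_preimage_emb (measurableEmbedding_addRight w) h
    (openRect (fun j => a j + w j) (fun j => b j + w j))
  rw [hpre] at h1 h2
  rw [h1, h2]

lemma rectMaximal_mono {h k : EuclideanSpace ℝ (Fin d) → ℝ≥0∞} (hk : ∀ y, h y ≤ k y)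
    (x : EuclideanSpace ℝ (Fin d)) :
    rectMaximal h x ≤ rectMaximal k x :=
  iSup₂_mono fun _ _ => iSup₂_mono fun _ _ => rectAverage_mono hk

lemma rectMaximal_const_le (c : ℝ≥0∞) (x : EuclideanSpace ℝ (Fin d)) : rectMaximal
    (fun _ => c) x ≤ c :=
  iSup₂_le fun _ _ => iSup₂_le fun hab _ => (rectAverage_const hab c).le

lemma rectMaximal_add_le {h : EuclideanSpace ℝ (Fin d) → ℝ≥0∞} (hh : AEMeasurable h)
    (k : EuclideanSpace ℝ (Fin d) → ℝ≥0∞) (x : EuclideanSpace ℝ (Fin d)) :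
    rectMaximal (fun y => h y + k y) x ≤ rectMaximal h x + rectMaximal k x := by
  refine iSup₂_le fun a b => iSup₂_le fun hab hx => ?_
  rw [rectAverage_add hh]
  exact add_le_add (rectAverage_le_rectMaximal hab hx h) (rectAverage_le_rectMaximal hab hx k)

lemma rectMaximal_const_mul_le {c : ℝ≥0∞} (hc : c ≠ ⊤) (h : EuclideanSpace ℝ (Fin d) → ℝ≥0∞)
    (x : EuclideanSpace ℝ (Fin d)) :
    rectMaximal (fun y => c * h y) x ≤ c * rectMaximal h x := by
  refine iSup₂_le fun a b => iSup₂_le fun hab hx => ?_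
  rw [rectAverage_const_mul a b hc]
  exact mul_le_mul_right (rectAverage_le_rectMaximal hab hx h) _

lemma rectMaximal_add_right_le (h : EuclideanSpace ℝ (Fin d) → ℝ≥0∞)
    (x w : EuclideanSpace ℝ (Fin d)) :
    rectMaximal h (x + w) ≤ rectMaximal (fun y => h (y + w)) x := by
  refine iSup₂_le fun a b => iSup₂_le fun hab hx => ?_
  have ha : a = fun j => (a j - w j) + w j := by ext j; simp
  have hb : b = fun j => (b j - w j) + w j := by ext j; simp
  rw [ha, hb] at hx ⊢
  rw [rectAverage_translate (fun j => a j - w j) (fun j => b j - w j)]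
  rw [mem_openRect_add] at hx
  exact rectAverage_le_rectMaximal (fun j => by simpa using hab j) hx _

lemma rectMaximal_translate (h : EuclideanSpace ℝ (Fin d) → ℝ≥0∞) (x w : EuclideanSpace ℝ (Fin d)) :
    rectMaximal (fun y => h (y + w)) x = rectMaximal h (x + w) := by
  refine le_antisymm ?_ (rectMaximal_add_right_le h x w)
  have := rectMaximal_add_right_le (fun y => h (y + w)) (x + w) (-w)
  simpa using this

/-- A supremum, even uncountable, of nonnegative constants times indicators of open rectangles is
lower semicontinuous. -/
lemma measurable_rectMaximal (h : EuclideanSpace ℝ (Fin d) → ℝ≥0∞) : Measurable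
    (rectMaximal h) := by
  refine LowerSemicontinuous.measurable ?_
  refine lowerSemicontinuous_iSup fun a => lowerSemicontinuous_iSup fun b =>
    lowerSemicontinuous_iSup fun hab => ?_
  have := (isOpen_openRect a b).lowerSemicontinuous_indicator (zero_le (a := rectAverage a b h))
  convert this using 2 with x
  by_cases hx : x ∈ openRect a b <;> simp [hx]

end RectAlgebra

/-! ### Powers of the strong maximal function as capacity test functions. -/

/-- A Lipschitz function in `L^p` with line derivatives along the axes in `L^p` is in `W^{1,p}`. -/
lemma LipschitzWith.sobolevPair {d : ℕ} {p : ℝ} (hp : 1 < p) {u : EuclideanSpace ℝ (Fin d) → ℝ}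
    {L : ℝ≥0} (hu : LipschitzWith L u) (hup : ∫⁻ x, ‖u x‖ₑ ^ p ≠ ⊤)
    (hgp : ∫⁻ x, ‖(WithLp.toLp 2 fun j => lineDeriv ℝ u x (EuclideanSpace.single j 1) :
      EuclideanSpace ℝ (Fin d))‖ₑ ^ p ≠ ⊤) :
    SobolevPair p u fun x => WithLp.toLp 2 fun j =>
      lineDeriv ℝ u x (EuclideanSpace.single j 1) := by
  have hp0 : ENNReal.ofReal p ≠ 0 := by simpa using (by linarith : 0 < p)
  have hp1 : (1 : ℝ≥0∞) ≤ ENNReal.ofReal p := by simpa using hp.le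
  have hreal : (ENNReal.ofReal p).toReal = p := ENNReal.toReal_ofReal (by linarith)
  have hmeas : Measurable fun x => (WithLp.toLp 2 fun j =>
      lineDeriv ℝ u x (EuclideanSpace.single j 1) : EuclideanSpace ℝ (Fin d)) :=
    (PiLp.volume_preserving_toLp (Fin d)).measurable.comp
      (measurable_pi_lambda _ fun j => measurable_lineDeriv hu.continuous)
  have h1 : MemLp u (ENNReal.ofReal p) := by
    refine ⟨hu.continuous.aestronglyMeasurable, ?_⟩
    rw [eLpNorm_lt_top_iff_lintegral_rpow_enorm_lt_top hp0 ENNReal.ofReal_ne_top, hreal]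
    exact hup.lt_top
  have h2 : MemLp (fun x => (WithLp.toLp 2 fun j =>
      lineDeriv ℝ u x (EuclideanSpace.single j 1) : EuclideanSpace ℝ (Fin d)))
      (ENNReal.ofReal p) := by
    refine ⟨hmeas.aestronglyMeasurable, ?_⟩
    rw [eLpNorm_lt_top_iff_lintegral_rpow_enorm_lt_top hp0 ENNReal.ofReal_ne_top, hreal]
    exact hgp.lt_top
  refine ⟨⟨h1.locallyIntegrable hp1, h2.locallyIntegrable hp1, fun φ hφ hφc j => ?_⟩, h1, h2⟩
  obtain ⟨D, hD⟩ := ContDiff.lipschitzWith_of_hasCompactSupport hφc hφ (by simp)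
  have := hu.integral_lineDeriv_mul_eq (μ := volume) hD hφc (EuclideanSpace.single j 1)
  rw [show (fun x => (WithLp.toLp 2 fun j => lineDeriv ℝ u x (EuclideanSpace.single j 1) :
    EuclideanSpace ℝ (Fin d)) j * φ x) = fun x => lineDeriv ℝ u x (EuclideanSpace.single j 1) * φ x
    from rfl, this, ← integral_neg]
  refine integral_congr_ae (ae_of_all _ fun x => ?_)
  dsimp only
  rw [((hφ.differentiable (by simp)) x).lineDeriv_eq_fderiv]
  simp [mul_comm]

/-- A crude Young inequality: replace both bases by the larger one. -/
lemma ENNReal.rpow_mul_rpow_le_add (a b : ℝ≥0∞) {s t : ℝ} (hs : 0 ≤ s) (ht : 0 ≤ t) :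
    a ^ s * b ^ t ≤ a ^ (s + t) + b ^ (s + t) := by
  rcases le_total a b with h | h
  · calc a ^ s * b ^ t ≤ b ^ s * b ^ t := by gcongr
      _ = b ^ (s + t) := (ENNReal.rpow_add_of_nonneg _ _ hs ht).symm
      _ ≤ _ := le_add_self
  · calc a ^ s * b ^ t ≤ a ^ s * a ^ t := by gcongr
      _ = a ^ (s + t) := (ENNReal.rpow_add_of_nonneg _ _ hs ht).symm
      _ ≤ _ := le_self_add

section TestFunction

variable {d : ℕ}

lemma rectMaximal_le_add_of_norm_sub_le {g k : EuclideanSpace ℝ (Fin d) → ℝ} (hk : Measurable k)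
    {c : ℝ}
    (h : ∀ y, |g y - k y| ≤ c) (x : EuclideanSpace ℝ (Fin d)) :
    rectMaximal (fun y => ‖g y‖ₑ) x ≤ rectMaximal (fun y => ‖k y‖ₑ) x + ENNReal.ofReal c := by
  calc rectMaximal (fun y => ‖g y‖ₑ) x ≤ rectMaximal (fun y => ‖k y‖ₑ + ENNReal.ofReal c) x := by
        refine rectMaximal_mono (fun y => ?_) x
        calc ‖g y‖ₑ = ‖k y + (g y - k y)‖ₑ := by congr 1; ring
          _ ≤ ‖k y‖ₑ + ‖g y - k y‖ₑ := enorm_add_le _ _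
          _ ≤ _ := by
            gcongr
            rw [Real.enorm_eq_ofReal_abs]
            exact ENNReal.ofReal_le_ofReal (h y)
    _ ≤ _ := (rectMaximal_add_le hk.enorm.aemeasurable _ x).trans
        (by gcongr; exact rectMaximal_const_le _ x)

/-- A bounded Lipschitz function `g` with partial derivatives `D j` which approximate the
difference quotients of `g` uniformly. -/
structure UniformC1 (g : EuclideanSpace ℝ (Fin d) → ℝ) (D : Fin d → EuclideanSpace ℝ (Fin d) → ℝ) :
    Prop where
  measurable_deriv : ∀ j, Measurable (D j)
  bounded : ∃ B, ∀ x, |g x| ≤ B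
  lipschitz : ∃ L, LipschitzWith L g
  approx : ∃ K : ℝ, ∀ j x, ∀ t : ℝ, |t| ≤ 1 →
    |g (x + t • EuclideanSpace.single j 1) - g x - t * D j x| ≤ K * t ^ 2

namespace UniformC1

variable {g : EuclideanSpace ℝ (Fin d) → ℝ} {D : Fin d → EuclideanSpace ℝ (Fin d) → ℝ}

lemma rectMaximal_ne_top (hg : UniformC1 g D) (x : EuclideanSpace ℝ (Fin d)) : rectMaximal
    (fun y => ‖g y‖ₑ) x ≠ ⊤ := by
  obtain ⟨B, hB⟩ := hg.bounded
  refine ne_top_of_le_ne_top (ENNReal.ofReal_ne_top (r := B))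
    ((rectMaximal_mono (fun y => ?_) x).trans (rectMaximal_const_le _ x))
  rw [Real.enorm_eq_ofReal_abs]
  exact ENNReal.ofReal_le_ofReal (hB y)

lemma measurable (hg : UniformC1 g D) : Measurable g := by
  obtain ⟨L, hL⟩ := hg.lipschitz
  exact hL.continuous.measurable

lemma exists_toReal_rectMaximal_le (hg : UniformC1 g D) :
    ∃ B, ∀ x, (rectMaximal (fun y => ‖g y‖ₑ) x).toReal ≤ B := by
  obtain ⟨B, hB⟩ := hg.bounded
  refine ⟨B, fun x => ENNReal.toReal_le_of_le_ofReal ((abs_nonneg _).trans (hB x))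
    ((rectMaximal_mono (fun y => ?_) x).trans (rectMaximal_const_le _ x))⟩
  rw [Real.enorm_eq_ofReal_abs]
  exact ENNReal.ofReal_le_ofReal (hB y)

/-- Translating $g$ by $x-y$ changes it uniformly by at most $L|x-y|$, and $M$ commutes with
translations and does not expand uniform distances. -/
lemma exists_lipschitzWith_rectMaximal (hg : UniformC1 g D) :
    ∃ L, LipschitzWith L fun x => (rectMaximal (fun y => ‖g y‖ₑ) x).toReal := by
  obtain ⟨L, hL⟩ := hg.lipschitz
  refine ⟨L, LipschitzWith.of_le_add_mul L fun x y => ?_⟩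
  have h1 := rectMaximal_le_add_of_norm_sub_le (g := fun z => g (z + (x - y))) hg.measurable
    (c := L * dist x y) (fun z => by
      have := hL.dist_le_mul (z + (x - y)) z
      rwa [Real.dist_eq, dist_eq_norm, add_sub_cancel_left, ← dist_eq_norm] at this) y
  rw [rectMaximal_translate (fun z => ‖g z‖ₑ), add_sub_cancel] at h1
  have h2 := ENNReal.toReal_mono (ENNReal.add_ne_top.2 ⟨hg.rectMaximal_ne_top y,
    ENNReal.ofReal_ne_top⟩) h1
  rwa [ENNReal.toReal_add (hg.rectMaximal_ne_top y) ENNReal.ofReal_ne_top,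
    ENNReal.toReal_ofReal (by positivity)] at h2

/-- Sublinearity applied to $g(\cdot+te_j)=g+tD_j+O(t^2)$ and to the same identity solved for $g$.
Both bounds thus carry the maximal function of $D_j$ at the same point $x$. -/
lemma rectMaximal_add_smul_le (hg : UniformC1 g D) : ∃ K : ℝ, ∀ j x, ∀ t : ℝ, |t| ≤ 1 →
    rectMaximal (fun y => ‖g y‖ₑ) (x + t • EuclideanSpace.single j 1) ≤
      rectMaximal (fun y => ‖g y‖ₑ) x + (ENNReal.ofReal |t| * rectMaximal (fun y => ‖D j y‖ₑ) x
        + ENNReal.ofReal (K * t ^ 2)) ∧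
    rectMaximal (fun y => ‖g y‖ₑ) x ≤
      rectMaximal (fun y => ‖g y‖ₑ) (x + t • EuclideanSpace.single j 1) +
        (ENNReal.ofReal |t| * rectMaximal (fun y => ‖D j y‖ₑ) x + ENNReal.ofReal (K * t ^ 2)) := by
  obtain ⟨K, hK⟩ := hg.approx
  refine ⟨K, fun j x t ht => ?_⟩
  set w : EuclideanSpace ℝ (Fin d) := t • EuclideanSpace.single j 1 with hw
  have hgw : Measurable fun y => g (y + w) := hg.measurable.comp (measurable_add_const w)
  have hD : Measurable fun y => t * D j y := (hg.measurable_deriv j).const_mul t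
  have hDle : rectMaximal (fun y => ‖t * D j y‖ₑ) x ≤
      ENNReal.ofReal |t| * rectMaximal (fun y => ‖D j y‖ₑ) x := by
    simp only [enorm_mul, Real.enorm_eq_ofReal_abs t]
    exact rectMaximal_const_mul_le ENNReal.ofReal_ne_top _ x
  rw [← rectMaximal_translate (fun y => ‖g y‖ₑ)]
  constructor
  · have h1 := rectMaximal_le_add_of_norm_sub_le (g := fun y => g (y + w))
      (k := fun y => g y + t * D j y) (hg.measurable.add hD) (c := K * t ^ 2)
      (fun y => by have := hK j y t ht; rwa [sub_sub] at this) x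
    refine h1.trans ?_
    rw [← add_assoc]
    gcongr
    refine le_trans (rectMaximal_mono (fun y => enorm_add_le _ _) x)
      ((rectMaximal_add_le hg.measurable.enorm.aemeasurable _ x).trans ?_)
    gcongr
  · have h1 := rectMaximal_le_add_of_norm_sub_le (g := g)
      (k := fun y => g (y + w) - t * D j y) (hgw.sub hD) (c := K * t ^ 2)
      (fun y => by
        have := hK j y t ht
        rw [abs_sub_comm]
        convert this using 2
        ring) x
    refine h1.trans ?_
    rw [← add_assoc]
    gcongr
    refine le_trans (rectMaximal_mono (fun y => enorm_sub_le) x)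
      ((rectMaximal_add_le hgw.enorm.aemeasurable _ x).trans ?_)
    gcongr

/-- Divide the two-sided increment bound by $|t|$ and let $t\to0$; the quadratic error disappears.
-/
lemma enorm_le_rectMaximal_of_hasLineDerivAt (hg : UniformC1 g D) {x : EuclideanSpace ℝ (Fin d)}
    {j : Fin d} {v' : ℝ}
    (hv : HasLineDerivAt ℝ (fun x => (rectMaximal (fun y => ‖g y‖ₑ) x).toReal) v' x
      (EuclideanSpace.single j 1)) :
    ‖v'‖ₑ ≤ rectMaximal (fun y => ‖D j y‖ₑ) x := by
  rcases eq_or_ne (rectMaximal (fun y => ‖D j y‖ₑ) x) ⊤ with htop | htop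
  · simp [htop]
  obtain ⟨K, hK⟩ := hg.rectMaximal_add_smul_le
  rw [Real.enorm_eq_ofReal_abs, ENNReal.ofReal_le_iff_le_toReal htop]
  refine le_of_forall_pos_le_add fun ε hε => ?_
  rw [← Real.norm_eq_abs]
  refine HasDerivAt.le_of_lip' hv (by positivity) ?_
  have hsmall : ∀ᶠ t : ℝ in 𝓝 0, |t| ≤ 1 ∧ |K| * |t| ≤ ε := by
    have h1 : Tendsto (fun t : ℝ => |t|) (𝓝 0) (𝓝 0) := by
      simpa using (continuous_abs (G := ℝ)).tendsto 0
    have h2 : Tendsto (fun t : ℝ => |K| * |t|) (𝓝 0) (𝓝 0) := by simpa using h1.const_mul |K|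
    exact (h1.eventually_le_const one_pos).and (h2.eventually_le_const hε)
  filter_upwards [hsmall] with t ht
  obtain ⟨h1, h2⟩ := hK j x t ht.1
  simp only [zero_smul, add_zero, sub_zero, Real.norm_eq_abs]
  set A := rectMaximal (fun y => ‖g y‖ₑ) (x + t • EuclideanSpace.single j 1)
  set B := rectMaximal (fun y => ‖g y‖ₑ) x
  set M := rectMaximal (fun y => ‖D j y‖ₑ) x
  have hA : A ≠ ⊤ := hg.rectMaximal_ne_top _
  have hB : B ≠ ⊤ := hg.rectMaximal_ne_top _
  have hR : ENNReal.ofReal |t| * M + ENNReal.ofReal (K * t ^ 2) ≤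
      ENNReal.ofReal ((M.toReal + ε) * |t|) := by
    rw [add_mul, ENNReal.ofReal_add (by positivity) (by positivity),
      ENNReal.ofReal_mul ENNReal.toReal_nonneg, ENNReal.ofReal_toReal htop, mul_comm]
    refine add_le_add_right (ENNReal.ofReal_le_ofReal ?_) _
    calc K * t ^ 2 ≤ |K| * t ^ 2 := by gcongr; exact le_abs_self K
      _ = |K| * |t| * |t| := by rw [← sq_abs]; ring
      _ ≤ ε * |t| := by gcongr; exact ht.2
  have hT : ENNReal.ofReal ((M.toReal + ε) * |t|) ≠ ⊤ := ENNReal.ofReal_ne_top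
  have h1' := ENNReal.toReal_mono (ENNReal.add_ne_top.2 ⟨hB, hT⟩)
    (h1.trans (add_le_add_right hR B))
  have h2' := ENNReal.toReal_mono (ENNReal.add_ne_top.2 ⟨hA, hT⟩)
    (h2.trans (add_le_add_right hR A))
  rw [ENNReal.toReal_add hB hT, ENNReal.toReal_ofReal (by positivity)] at h1'
  rw [ENNReal.toReal_add hA hT, ENNReal.toReal_ofReal (by positivity)] at h2'
  rw [abs_le]
  constructor <;> linarith

end UniformC1

/-- For `p ≤ q`, the power `q / p` of the strong maximal function of `g` is an admissible test
function, controlled by the `W^{1,q}`-norm of `g`, for the `p`-capacity of the superlevel set. -/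
lemma exists_sobolevPair_of_uniformC1 (d : ℕ) {p q : ℝ} (hp : 1 < p) (hpq : p ≤ q) :
    ∃ C : ℝ≥0∞, C ≠ ⊤ ∧ ∀ (g : EuclideanSpace ℝ (Fin d) → ℝ)
      (D : Fin d → EuclideanSpace ℝ (Fin d) → ℝ), UniformC1 g D →
      ∫⁻ x, ‖g x‖ₑ ^ q ≠ ⊤ → (∀ j, ∫⁻ x, ‖D j x‖ₑ ^ q ≠ ⊤) →
      ∃ u G, SobolevPair p u G ∧ (∀ x, 0 ≤ u x) ∧
        (∀ x, 1 < rectMaximal (fun y => ‖g y‖ₑ) x → 1 ≤ u x) ∧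
        IsOpen {x | 1 < rectMaximal (fun y => ‖g y‖ₑ) x} ∧
        ∫⁻ x, ‖u x‖ₑ ^ p ≤ C * ((∫⁻ x, ‖g x‖ₑ ^ q) + ∑ j, ∫⁻ x, ‖D j x‖ₑ ^ q) ∧
        ∫⁻ x, ‖G x‖ₑ ^ p ≤ C * ((∫⁻ x, ‖g x‖ₑ ^ q) + ∑ j, ∫⁻ x, ‖D j x‖ₑ ^ q) := by
  have hp0 : 0 < p := by linarith
  have hq : 1 < q := by linarith
  obtain ⟨C, hC, HC⟩ := lintegral_rectMaximal_rpow_le d hq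
  set s : ℝ := q / p with hs
  have hs1 : 1 ≤ s := by rw [hs, le_div_iff₀ hp0]; linarith
  have hsp : s * p = q := by rw [hs]; field_simp
  -- Sources of the factors: $d^{p-1}$ from the $p$-th power of a sum over coordinates, $s^p$ from
  -- the chain rule, $d+1$ because the term in $g$ occurs once per coordinate, $C$ from the strong
  -- maximal theorem.
  set T : ℝ≥0∞ := (d : ℝ≥0∞) ^ (p - 1) * ENNReal.ofReal s ^ p * (d + 1) * C with hT
  have hTtop : T ≠ ⊤ := by
    refine ENNReal.mul_ne_top (ENNReal.mul_ne_top (ENNReal.mul_ne_top ?_ ?_) ?_) hC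
    · exact ENNReal.rpow_ne_top_of_nonneg (by linarith) (by simp)
    · exact ENNReal.rpow_ne_top_of_nonneg (by linarith) (by simp)
    · simp
  refine ⟨max C T, (max_lt hC.lt_top hTtop.lt_top).ne, fun g D hg hgq hDq => ?_⟩
  set S := (∫⁻ x, ‖g x‖ₑ ^ q) + ∑ j, ∫⁻ x, ‖D j x‖ₑ ^ q with hS
  have hStop : S ≠ ⊤ := ENNReal.add_ne_top.2 ⟨hgq, ENNReal.sum_ne_top.2 fun j _ => hDq j⟩
  set M := rectMaximal (fun y => ‖g y‖ₑ) with hM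
  have hMtop : ∀ x, M x ≠ ⊤ := hg.rectMaximal_ne_top
  obtain ⟨L, hL⟩ := hg.exists_lipschitzWith_rectMaximal
  obtain ⟨B, hB⟩ := hg.exists_toReal_rectMaximal_le
  -- As $s\ge1$, the power $t^s$ is $C^1$, hence Lipschitz on the bounded range of the maximal
  -- function.
  obtain ⟨K, hK⟩ := ((Real.contDiff_rpow_const_of_le (n := 1)
    (by simpa using hs1)).locallyLipschitz.locallyLipschitzOn
      (s := Icc 0 B)).exists_lipschitzOnWith_of_compact isCompact_Icc
  set u : EuclideanSpace ℝ (Fin d) → ℝ := fun x => (M x).toReal ^ s with hu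
  have huL : LipschitzWith (K * L) u := by
    rw [← lipschitzOnWith_univ]
    exact hK.comp hL.lipschitzOnWith fun x _ => ⟨ENNReal.toReal_nonneg, hB x⟩
  have hue : ∀ x, ‖u x‖ₑ ^ p = M x ^ q := by
    intro x
    rw [Real.enorm_eq_ofReal (by positivity), ← ENNReal.ofReal_rpow_of_nonneg
      ENNReal.toReal_nonneg (by linarith), ENNReal.ofReal_toReal (hMtop x), ← ENNReal.rpow_mul, hsp]
  have hup : ∫⁻ x, ‖u x‖ₑ ^ p ≤ C * S := by
    simp only [hue]
    exact (HC _ hg.measurable.enorm).trans (mul_le_mul_right le_self_add _)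
  have hder : ∀ j, ∀ᵐ x, ‖lineDeriv ℝ u x (EuclideanSpace.single j 1)‖ₑ ^ p ≤
      ENNReal.ofReal s ^ p * (M x ^ q + rectMaximal (fun y => ‖D j y‖ₑ) x ^ q) := by
    intro j
    filter_upwards [hL.ae_lineDifferentiableAt (μ := volume) (EuclideanSpace.single j 1)] with x hx
    have h1 := hx.hasLineDerivAt
    have h2 := hg.enorm_le_rectMaximal_of_hasLineDerivAt h1
    set v' := lineDeriv ℝ (fun x => (M x).toReal) x (EuclideanSpace.single j 1)
    have h3 : HasLineDerivAt ℝ u (v' * s * (M x).toReal ^ (s - 1)) x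
        (EuclideanSpace.single j 1) := by
      have := HasDerivAt.rpow_const (p := s) h1 (Or.inr hs1)
      simpa [HasLineDerivAt] using this
    rw [h3.lineDeriv, enorm_mul, enorm_mul, Real.enorm_eq_ofReal (by linarith : 0 ≤ s),
      Real.enorm_eq_ofReal (by positivity : 0 ≤ (M x).toReal ^ (s - 1)),
      ← ENNReal.ofReal_rpow_of_nonneg ENNReal.toReal_nonneg (by linarith),
      ENNReal.ofReal_toReal (hMtop x), ENNReal.mul_rpow_of_nonneg _ _ hp0.le,
      ENNReal.mul_rpow_of_nonneg _ _ hp0.le, ← ENNReal.rpow_mul]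
    -- The chain rule produces $M^{(s-1)p}$ times a $p$-th power; the exponents add up to $sp=q$.
    have h4 := ENNReal.rpow_mul_rpow_le_add (M x) (rectMaximal (fun y => ‖D j y‖ₑ) x)
      (s := (s - 1) * p) (t := p) (by nlinarith) hp0.le
    rw [show (s - 1) * p + p = q by rw [← hsp]; ring] at h4
    calc _ = ENNReal.ofReal s ^ p * (M x ^ ((s - 1) * p) * ‖v'‖ₑ ^ p) := by ring
      _ ≤ _ := by
        gcongr
        refine le_trans ?_ h4
        gcongr
  have hGp : ∫⁻ x, ‖(WithLp.toLp 2 fun j => lineDeriv ℝ u x (EuclideanSpace.single j 1) :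
      EuclideanSpace ℝ (Fin d))‖ₑ ^ p ≤ T * S := by
    calc _ ≤ ∫⁻ x, (d : ℝ≥0∞) ^ (p - 1) *
          ∑ j, ‖lineDeriv ℝ u x (EuclideanSpace.single j 1)‖ₑ ^ p := by
          refine lintegral_mono fun x => ?_
          have h1 : ‖(WithLp.toLp 2 fun j => lineDeriv ℝ u x (EuclideanSpace.single j 1) :
              EuclideanSpace ℝ (Fin d))‖ₑ ≤
              ∑ j, ‖lineDeriv ℝ u x (EuclideanSpace.single j 1)‖ₑ := by
            set z : EuclideanSpace ℝ (Fin d) := WithLp.toLp 2 fun j =>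
              lineDeriv ℝ u x (EuclideanSpace.single j 1)
            have hz : z = ∑ j, EuclideanSpace.single j (z j) := by
              ext i
              simp
            calc ‖z‖ₑ = ‖∑ j, EuclideanSpace.single j (z j)‖ₑ := by rw [← hz]
              _ ≤ ∑ j, ‖EuclideanSpace.single j (z j)‖ₑ := enorm_sum_le _ _
              _ = ∑ j, ‖z j‖ₑ := by
                refine Finset.sum_congr rfl fun j _ => ?_
                rw [← ofReal_norm, ← ofReal_norm, PiLp.norm_single]
          refine (ENNReal.rpow_le_rpow h1 hp0.le).trans ?_
          have := ENNReal.rpow_sum_le_const_mul_sum_rpow Finset.univ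
            (fun j => ‖lineDeriv ℝ u x (EuclideanSpace.single j 1)‖ₑ) hp.le
          simpa using this
      _ ≤ ∫⁻ x, (d : ℝ≥0∞) ^ (p - 1) * ∑ j, ENNReal.ofReal s ^ p *
          (M x ^ q + rectMaximal (fun y => ‖D j y‖ₑ) x ^ q) := by
          refine lintegral_mono_ae ?_
          filter_upwards [ae_all_iff.2 hder] with x hx
          gcongr with j
          exact hx j
      _ = (d : ℝ≥0∞) ^ (p - 1) * ∑ j, ENNReal.ofReal s ^ p *
          ((∫⁻ x, M x ^ q) + ∫⁻ x, rectMaximal (fun y => ‖D j y‖ₑ) x ^ q) := by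
          have hm : ∀ j, Measurable fun x => M x ^ q + rectMaximal (fun y => ‖D j y‖ₑ) x ^ q :=
            fun j => ((measurable_rectMaximal _).pow_const q).add
              ((measurable_rectMaximal _).pow_const q)
          rw [lintegral_const_mul _ (Finset.measurable_sum _ fun j _ => (hm j).const_mul _),
            lintegral_finsetSum _ fun j _ => (hm j).const_mul _]
          congr 1
          refine Finset.sum_congr rfl fun j _ => ?_
          rw [lintegral_const_mul _ (hm j),
            lintegral_add_left ((measurable_rectMaximal _).pow_const q)]
      _ ≤ (d : ℝ≥0∞) ^ (p - 1) * ∑ j, ENNReal.ofReal s ^ p *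
          (C * (∫⁻ x, ‖g x‖ₑ ^ q) + C * ∫⁻ x, ‖D j x‖ₑ ^ q) := by
          gcongr with j
          · exact HC _ hg.measurable.enorm
          · exact HC _ (hg.measurable_deriv j).enorm
      _ = (d : ℝ≥0∞) ^ (p - 1) * ENNReal.ofReal s ^ p * C *
          (d * (∫⁻ x, ‖g x‖ₑ ^ q) + ∑ j, ∫⁻ x, ‖D j x‖ₑ ^ q) := by
          rw [← Finset.mul_sum, Finset.sum_add_distrib, ← Finset.mul_sum, ← Finset.mul_sum]
          simp only [Finset.sum_const, Finset.card_univ, Fintype.card_fin, nsmul_eq_mul]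
          ring
      _ ≤ (d : ℝ≥0∞) ^ (p - 1) * ENNReal.ofReal s ^ p * C * ((d + 1) * S) := by
          gcongr
          rw [hS, mul_add]
          gcongr
          · exact le_self_add
          · exact le_mul_of_one_le_left zero_le le_add_self
      _ = T * S := by rw [hT]; ring
  refine ⟨u, _, huL.sobolevPair hp (ne_top_of_le_ne_top (ENNReal.mul_ne_top hC hStop) hup)
    (ne_top_of_le_ne_top (ENNReal.mul_ne_top hTtop hStop) hGp), fun x => by positivity,
    fun x hx => ?_, ?_, hup.trans ?_, hGp.trans ?_⟩
  · refine Real.one_le_rpow ?_ (by linarith)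
    rw [← ENNReal.toReal_one]
    exact ENNReal.toReal_mono (hMtop x) hx.le
  · have : {x | 1 < M x} = (fun x => (M x).toReal) ⁻¹' Ioi 1 := by
      ext x
      rw [mem_preimage, mem_Ioi, ← ENNReal.toReal_one, ENNReal.toReal_lt_toReal (by simp) (hMtop x)]
      rfl
    rw [this]
    exact isOpen_Ioi.preimage hL.continuous
  · gcongr; exact le_max_left _ _
  · gcongr; exact le_max_right _ _

end TestFunction

/-! ### Mollification of Sobolev functions. -/

section Jensen

lemma lintegral_rpow_le_lintegral_rpow {α : Type*} [MeasurableSpace α] (ν : Measure α)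
    [IsProbabilityMeasure ν] {q : ℝ} (hq : 1 < q) {h : α → ℝ≥0∞} (hh : AEMeasurable h ν) :
    (∫⁻ z, h z ∂ν) ^ q ≤ ∫⁻ z, h z ^ q ∂ν := by
  have hq0 : 0 < q := by linarith
  have := ENNReal.lintegral_mul_le_Lp_mul_Lq ν (Real.HolderConjugate.conjExponent hq) hh
    (aemeasurable_const (b := (1 : ℝ≥0∞)))
  simp only [Pi.mul_apply, mul_one, ENNReal.one_rpow, lintegral_const, measure_univ] at this
  calc _ ≤ ((∫⁻ z, h z ^ q ∂ν) ^ (1 / q)) ^ q := ENNReal.rpow_le_rpow this hq0.le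
    _ = _ := by rw [← ENNReal.rpow_mul, one_div, inv_mul_cancel₀ hq0.ne', ENNReal.rpow_one]

end Jensen

section Smoothing

variable {d : ℕ}

/-- The convolution of `f` with the kernel `φ`. -/
noncomputable def smoothing (φ f : EuclideanSpace ℝ (Fin d) → ℝ) (x : EuclideanSpace ℝ (Fin d)) :
    ℝ :=
  ∫ y, φ (x - y) * f y

lemma smoothing_congr_ae (φ : EuclideanSpace ℝ (Fin d) → ℝ) {f g : EuclideanSpace ℝ (Fin d) → ℝ}
    (h : f =ᵐ[volume] g) : smoothing φ f = smoothing φ g := by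
  funext x
  refine integral_congr_ae ?_
  filter_upwards [h] with y hy
  rw [hy]

lemma integrable_smoothing {φ f : EuclideanSpace ℝ (Fin d) → ℝ} (hφ : Continuous φ)
    (hφc : HasCompactSupport φ) (hf : LocallyIntegrable f) (x : EuclideanSpace ℝ (Fin d)) :
    Integrable fun y => φ (x - y) * f y :=
  hf.integrable_smul_left_of_hasCompactSupport (hφ.comp (continuous_const.sub continuous_id))
    (hφc.comp_homeomorph (Homeomorph.subLeft x))

/-- From $|f|\le1+|f|^q$; the bound is uniform in the centre because the volume of a ball does not
depend on it. -/
lemma exists_setLIntegral_closedBall_le {q : ℝ} (hq : 1 ≤ q) {f : EuclideanSpace ℝ (Fin d) → ℝ}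
    (hf : ∫⁻ x, ‖f x‖ₑ ^ q ≠ ⊤) (R : ℝ) :
    ∃ N : ℝ≥0, ∀ x, ∫⁻ y in closedBall x R, ‖f y‖ₑ ≤ N := by
  have hfin : volume (closedBall (0 : EuclideanSpace ℝ (Fin d)) R) + ∫⁻ x, ‖f x‖ₑ ^ q ≠ ⊤ :=
    ENNReal.add_ne_top.2 ⟨measure_closedBall_lt_top.ne, hf⟩
  refine ⟨(volume (closedBall (0 : EuclideanSpace ℝ (Fin d)) R) + ∫⁻ x, ‖f x‖ₑ ^ q).toNNReal,
    fun x => ?_⟩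
  rw [ENNReal.coe_toNNReal hfin]
  calc ∫⁻ y in closedBall x R, ‖f y‖ₑ ≤ ∫⁻ y in closedBall x R, (1 + ‖f y‖ₑ ^ q) := by
        refine lintegral_mono fun y => ?_
        rcases le_total ‖f y‖ₑ 1 with h | h
        · exact h.trans le_self_add
        · calc ‖f y‖ₑ = ‖f y‖ₑ ^ (1 : ℝ) := (ENNReal.rpow_one _).symm
            _ ≤ ‖f y‖ₑ ^ q := ENNReal.rpow_le_rpow_of_exponent_le h hq
            _ ≤ _ := le_add_self
    _ = volume (closedBall x R) + ∫⁻ y in closedBall x R, ‖f y‖ₑ ^ q := by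
        rw [lintegral_add_left measurable_const, setLIntegral_const, one_mul]
    _ ≤ _ := by
        rw [Measure.addHaar_closedBall_center]
        exact add_le_add_right (setLIntegral_le_lintegral _ _) _

/-- Used for the mollifier, its differences and its Taylor remainder, to turn uniform bounds on a
kernel into uniform bounds on the convolution. -/
lemma abs_integral_kernel_le {f ψ : EuclideanSpace ℝ (Fin d) → ℝ} {R c : ℝ} {N : ℝ≥0}
    (hN : ∀ x, ∫⁻ y in closedBall x R, ‖f y‖ₑ ≤ N) (hc : 0 ≤ c) (hψ : ∀ z, |ψ z| ≤ c)
    (hψR : ∀ z, R < ‖z‖ → ψ z = 0) (x : EuclideanSpace ℝ (Fin d)) :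
    |∫ y, ψ (x - y) * f y| ≤ c * N := by
  rw [← ENNReal.ofReal_le_ofReal_iff (by positivity), ← Real.enorm_eq_ofReal_abs]
  calc ‖∫ y, ψ (x - y) * f y‖ₑ ≤ ∫⁻ y, ‖ψ (x - y) * f y‖ₑ := enorm_integral_le_lintegral_enorm _
    _ ≤ ∫⁻ y in closedBall x R, ENNReal.ofReal c * ‖f y‖ₑ := by
        rw [← lintegral_indicator measurableSet_closedBall]
        refine lintegral_mono fun y => ?_
        by_cases hy : y ∈ closedBall x R
        · rw [indicator_of_mem hy, enorm_mul, Real.enorm_eq_ofReal_abs (ψ _)]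
          gcongr
          exact hψ _
        · rw [mem_closedBall, dist_comm, dist_eq_norm, not_le] at hy
          simp [hψR _ hy]
    _ = ENNReal.ofReal c * ∫⁻ y in closedBall x R, ‖f y‖ₑ :=
        lintegral_const_mul' _ _ ENNReal.ofReal_ne_top
    _ ≤ ENNReal.ofReal c * N := by gcongr; exact hN x
    _ = _ := by rw [ENNReal.ofReal_mul hc, ENNReal.ofReal_coe_nnreal]

lemma exists_forall_lt_norm_eq_zero {φ : EuclideanSpace ℝ (Fin d) → ℝ}
    (hφc : HasCompactSupport φ) : ∃ R : ℝ, 0 ≤ R ∧ ∀ z, R < ‖z‖ → φ z = 0 := by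
  obtain ⟨R, hR⟩ := hφc.isCompact.isBounded.subset_closedBall 0
  refine ⟨max R 0, le_max_right _ _, fun z hz => ?_⟩
  by_contra h
  have := hR (subset_tsupport _ h)
  rw [mem_closedBall_zero_iff] at this
  exact absurd (this.trans (le_max_left R 0)) (not_le.2 hz)

variable {q : ℝ} {φ f : EuclideanSpace ℝ (Fin d) → ℝ}

lemma exists_abs_smoothing_le (hq : 1 ≤ q) (hφ : Continuous φ) (hφc : HasCompactSupport φ)
    (hf : ∫⁻ x, ‖f x‖ₑ ^ q ≠ ⊤) : ∃ B, ∀ x, |smoothing φ f x| ≤ B := by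
  obtain ⟨R, -, hR⟩ := exists_forall_lt_norm_eq_zero hφc
  obtain ⟨N, hN⟩ := exists_setLIntegral_closedBall_le hq hf R
  obtain ⟨c, hc⟩ := hφ.bounded_above_of_compact_support hφc
  exact ⟨_, abs_integral_kernel_le hN ((norm_nonneg _).trans (hc 0)) hc hR⟩

lemma exists_lipschitzWith_smoothing (hq : 1 ≤ q) {K : ℝ≥0} (hφ : LipschitzWith K φ)
    (hφc : HasCompactSupport φ) (hfl : LocallyIntegrable f) (hf : ∫⁻ x, ‖f x‖ₑ ^ q ≠ ⊤) :
    ∃ L, LipschitzWith L (smoothing φ f) := by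
  obtain ⟨B, hB⟩ := exists_abs_smoothing_le hq hφ.continuous hφc hf
  obtain ⟨R, hR0, hR⟩ := exists_forall_lt_norm_eq_zero hφc
  obtain ⟨N, hN⟩ := exists_setLIntegral_closedBall_le hq hf (R + 1)
  have hB0 : 0 ≤ B := (abs_nonneg _).trans (hB 0)
  refine ⟨K * N + 2 * B.toNNReal, LipschitzWith.of_dist_le_mul fun x y => ?_⟩
  simp only [NNReal.coe_add, NNReal.coe_mul, Real.coe_toNNReal _ hB0, NNReal.coe_ofNat]
  rw [Real.dist_eq, dist_eq_norm]
  have hxy := norm_nonneg (x - y)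
  have hKN : (0 : ℝ) ≤ K * N := by positivity
  -- Nearby points: the difference of kernels is supported within radius $R+1$. Distant points: the
  -- uniform bound $B$ suffices.
  rcases le_total ‖x - y‖ 1 with h | h
  · have h1 : smoothing φ f x - smoothing φ f y =
        ∫ z, (fun w => φ (w + (x - y)) - φ w) (y - z) * f z := by
      unfold smoothing
      rw [← integral_sub (integrable_smoothing hφ.continuous hφc hfl x)
        (integrable_smoothing hφ.continuous hφc hfl y)]
      refine integral_congr_ae (ae_of_all _ fun z => ?_)
      dsimp only
      rw [show y - z + (x - y) = x - z by abel]
      ring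
    rw [h1]
    have h2 : |∫ z, (fun w => φ (w + (x - y)) - φ w) (y - z) * f z| ≤ K * ‖x - y‖ * N := by
      refine abs_integral_kernel_le (ψ := fun w => φ (w + (x - y)) - φ w) hN
        (by positivity) (fun w => ?_) (fun w hw => ?_) y
      · have := hφ.dist_le_mul (w + (x - y)) w
        rwa [Real.dist_eq, dist_eq_norm, add_sub_cancel_left] at this
      · have h2 : ‖w‖ ≤ ‖w + (x - y)‖ + ‖x - y‖ := by
          simpa using norm_sub_le (w + (x - y)) (x - y)
        rw [hR w (by linarith), hR (w + (x - y)) (by linarith), sub_zero]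
    calc _ ≤ K * ‖x - y‖ * N := h2
      _ = K * N * ‖x - y‖ := by ring
      _ ≤ _ := by gcongr; linarith
  · have := abs_sub (smoothing φ f x) (smoothing φ f y)
    nlinarith [hB x, hB y]

lemma exists_abs_taylor_le (hφ : ContDiff ℝ (⊤ : ℕ∞) φ) (hφc : HasCompactSupport φ) :
    ∃ K : ℝ, 0 ≤ K ∧ ∀ z w, |φ (z + w) - φ z - fderiv ℝ φ z w| ≤ K * ‖w‖ ^ 2 := by
  obtain ⟨K, hK⟩ := ContDiff.lipschitzWith_of_hasCompactSupport (hφc.fderiv ℝ)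
    (hφ.fderiv_right (m := (⊤ : ℕ∞)) (by simp)) (by simp)
  refine ⟨K, K.2, fun z w => ?_⟩
  have := (convex_closedBall z ‖w‖).norm_image_sub_le_of_norm_fderiv_le' (f := φ) (𝕜 := ℝ)
    (φ := fderiv ℝ φ z) (C := K * ‖w‖) (x := z) (y := z + w)
    (fun x _ => hφ.differentiable (by simp) x) (fun x hx => ?_) (by simp) (by simp)
  · rw [add_sub_cancel_left, Real.norm_eq_abs] at this
    rwa [sq, ← mul_assoc]
  · refine (hK.norm_sub_le x z).trans ?_
    rw [mem_closedBall, dist_eq_norm] at hx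
    gcongr

/-- Test the weak gradient with $y\mapsto\varphi(x-y)$; the sign from the reflection cancels that of
integration by parts. -/
lemma smoothing_fderiv_eq (hφ : ContDiff ℝ (⊤ : ℕ∞) φ) (hφc : HasCompactSupport φ)
    {G : EuclideanSpace ℝ (Fin d) → EuclideanSpace ℝ (Fin d)} (hfG : IsWeakGradient f G)
    (j : Fin d) (x : EuclideanSpace ℝ (Fin d)) :
    smoothing (fun z => fderiv ℝ φ z (EuclideanSpace.single j 1)) f x =
      smoothing φ (fun y => G y j) x := by
  have h := hfG.2.2 (fun y => φ (x - y)) (hφ.comp (contDiff_const.sub contDiff_id))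
    (hφc.comp_homeomorph (Homeomorph.subLeft x)) j
  have hd : ∀ y, fderiv ℝ (fun y => φ (x - y)) y (EuclideanSpace.single j 1) =
      - fderiv ℝ φ (x - y) (EuclideanSpace.single j 1) := by
    intro y
    have h1 : HasFDerivAt (fun y => φ (x - y)) ((fderiv ℝ φ (x - y)).comp
        (-ContinuousLinearMap.id ℝ (EuclideanSpace ℝ (Fin d)))) y :=
      HasFDerivAt.comp y (hφ.differentiable (by simp) (x - y)).hasFDerivAt
        ((hasFDerivAt_id y).const_sub x)
    rw [h1.fderiv]
    simp
  simp only [hd, mul_neg, integral_neg, neg_inj] at h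
  unfold smoothing
  simp only [mul_comm _ (f _), mul_comm _ (G _ _)]
  convert h using 3

/-- The first-order error of the convolution is the convolution with the Taylor remainder of
$\varphi$, which is at most $Kt^2$ and, for $|t|\le1$, supported in a fixed ball. -/
lemma uniformC1_smoothing (hq : 1 ≤ q) (hφ : ContDiff ℝ (⊤ : ℕ∞) φ) (hφc : HasCompactSupport φ)
    {G : EuclideanSpace ℝ (Fin d) → EuclideanSpace ℝ (Fin d)} (hfG : IsWeakGradient f G)
    (hf : ∫⁻ x, ‖f x‖ₑ ^ q ≠ ⊤) (hG : ∀ j, ∫⁻ x, ‖G x j‖ₑ ^ q ≠ ⊤) :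
    UniformC1 (smoothing φ f) fun j => smoothing φ fun y => G y j := by
  obtain ⟨L, hL⟩ := ContDiff.lipschitzWith_of_hasCompactSupport hφc hφ (by simp)
  have hGl : ∀ j, LocallyIntegrable fun y => G y j := fun j x => by
    obtain ⟨s, hs, hi⟩ := hfG.2.1 x
    exact ⟨s, hs, (EuclideanSpace.proj (𝕜 := ℝ) j).integrable_comp hi⟩
  refine ⟨fun j => ?_, exists_abs_smoothing_le hq hφ.continuous hφc hf,
    exists_lipschitzWith_smoothing hq hL hφc hfG.1 hf, ?_⟩
  · obtain ⟨M, hM⟩ := exists_lipschitzWith_smoothing hq hL hφc (hGl j) (hG j)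
    exact hM.continuous.measurable
  obtain ⟨K, hK0, hK⟩ := exists_abs_taylor_le hφ hφc
  obtain ⟨R, hR0, hR⟩ := exists_forall_lt_norm_eq_zero hφc
  obtain ⟨R', hR0', hR'⟩ : ∃ R' : ℝ, 0 ≤ R' ∧ ∀ z, R' < ‖z‖ → ∀ v, fderiv ℝ φ z v = 0 := by
    obtain ⟨R', hR'⟩ := (hφc.fderiv ℝ).isCompact.isBounded.subset_closedBall 0
    refine ⟨max R' 0, le_max_right _ _, fun z hz v => ?_⟩
    by_contra h
    have := hR' (subset_tsupport _ (show fderiv ℝ φ z ≠ 0 from fun h0 => h (by simp [h0])))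
    rw [mem_closedBall_zero_iff] at this
    exact absurd (this.trans (le_max_left R' 0)) (not_le.2 hz)
  obtain ⟨N, hN⟩ := exists_setLIntegral_closedBall_le hq hf (max R R' + 1)
  refine ⟨K * N, fun j x t ht => ?_⟩
  set e : EuclideanSpace ℝ (Fin d) := EuclideanSpace.single j 1 with he
  have hne : ‖t • e‖ = |t| := by rw [norm_smul, he]; simp
  have hdc : Continuous fun z => fderiv ℝ φ z e :=
    (hφ.continuous_fderiv (by simp)).clm_apply continuous_const
  have hdcs : HasCompactSupport fun z => fderiv ℝ φ z e :=
    (hφc.fderiv ℝ).comp_left (g := fun L : EuclideanSpace ℝ (Fin d) →L[ℝ] ℝ => L e) rfl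
  rw [← smoothing_fderiv_eq hφ hφc hfG j x]
  have h1 : smoothing φ f (x + t • e) - smoothing φ f x -
      t * smoothing (fun z => fderiv ℝ φ z e) f x =
      ∫ y, (fun z => φ (z + t • e) - φ z - fderiv ℝ φ z (t • e)) (x - y) * f y := by
    have i1 := integrable_smoothing hφ.continuous hφc hfG.1 (x + t • e)
    have i2 := integrable_smoothing hφ.continuous hφc hfG.1 x
    have i3 := (integrable_smoothing hdc hdcs hfG.1 x).const_mul t
    have i4 : Integrable fun y => φ (x + t • e - y) * f y - φ (x - y) * f y := i1.sub i2
    unfold smoothing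
    rw [← integral_sub i1 i2, ← integral_const_mul, ← integral_sub i4 i3]
    refine integral_congr_ae (ae_of_all _ fun z => ?_)
    dsimp only
    rw [map_smul, smul_eq_mul, show x - z + t • e = x + t • e - z by abel]
    ring
  rw [h1, mul_right_comm]
  refine abs_integral_kernel_le (ψ := fun z => φ (z + t • e) - φ z - fderiv ℝ φ z (t • e)) hN
    (c := K * t ^ 2) (by positivity) (fun z => ?_)
    (fun z hz => ?_) x
  · have := hK z (t • e)
    rwa [hne, sq_abs] at this
  · have h2 : ‖z‖ ≤ ‖z + t • e‖ + ‖t • e‖ := by simpa using norm_sub_le (z + t • e) (t • e)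
    have h3 := le_max_left R R'
    have h4 := le_max_right R R'
    rw [hR z (by linarith), hR (z + t • e) (by linarith), hR' z (by linarith)]
    simp

/-- As $\varphi\,dz$ is a probability measure, Jensen and Tonelli reduce the error to an average of
translation errors. -/
lemma lintegral_smoothing_sub_rpow_le (hq : 1 < q) (hφ : Continuous φ)
    (hφc : HasCompactSupport φ) (hφ0 : ∀ z, 0 ≤ φ z) (hφ1 : ∫ z, φ z = 1) (hfm : Measurable f)
    (hfl : LocallyIntegrable f) {η : ℝ≥0∞} {δ : ℝ} (hφδ : ∀ z, φ z ≠ 0 → ‖z‖ < δ)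
    (hη : ∀ z, ‖z‖ < δ → ∫⁻ x, ‖f (x - z) - f x‖ₑ ^ q ≤ η) :
    ∫⁻ x, ‖smoothing φ f x - f x‖ₑ ^ q ≤ η := by
  have hφi : Integrable φ := hφ.integrable_of_hasCompactSupport hφc
  set ν : Measure (EuclideanSpace ℝ (Fin d)) := volume.withDensity fun z => ‖φ z‖ₑ with hν
  have hφm : Measurable fun z => ‖φ z‖ₑ := hφ.measurable.enorm
  have hprob : IsProbabilityMeasure ν := by
    constructor
    rw [hν, withDensity_apply _ MeasurableSet.univ, Measure.restrict_univ]
    simp only [Real.enorm_eq_ofReal (hφ0 _)]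
    rw [← ofReal_integral_eq_lintegral_ofReal hφi (ae_of_all _ hφ0), hφ1, ENNReal.ofReal_one]
  have hpt : ∀ x, ‖smoothing φ f x - f x‖ₑ ^ q ≤ ∫⁻ z, ‖f (x - z) - f x‖ₑ ^ q ∂ν := by
    intro x
    have hi : Integrable fun z => φ z * f (x - z) := by
      have := (integrable_smoothing hφ hφc hfl x).comp_sub_left x
      simpa using this
    have h1 : smoothing φ f x - f x = ∫ z, φ z * (f (x - z) - f x) := by
      have h2 : smoothing φ f x = ∫ z, φ z * f (x - z) := by
        unfold smoothing
        rw [← integral_sub_left_eq_self _ _ x]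
        simp
      simp only [mul_sub]
      rw [integral_sub hi (hφi.mul_const _), integral_mul_const, hφ1, one_mul, h2]
    have hm : Measurable fun z => ‖f (x - z) - f x‖ₑ :=
      ((hfm.comp (measurable_const.sub measurable_id)).sub measurable_const).enorm
    rw [h1]
    refine le_trans (ENNReal.rpow_le_rpow ?_ (by linarith))
      (lintegral_rpow_le_lintegral_rpow ν hq hm.aemeasurable)
    refine (enorm_integral_le_lintegral_enorm _).trans (le_of_eq ?_)
    rw [hν, lintegral_withDensity_eq_lintegral_mul _ hφm hm]
    refine lintegral_congr fun z => ?_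
    rw [enorm_mul]; rfl
  calc ∫⁻ x, ‖smoothing φ f x - f x‖ₑ ^ q ≤ ∫⁻ x, ∫⁻ z, ‖f (x - z) - f x‖ₑ ^ q ∂ν :=
        lintegral_mono hpt
    _ = ∫⁻ z, (∫⁻ x, ‖f (x - z) - f x‖ₑ ^ q) ∂ν := by
        refine lintegral_lintegral_swap (Measurable.aemeasurable ?_)
        exact (((hfm.comp (measurable_fst.sub measurable_snd)).sub
          (hfm.comp measurable_fst)).enorm).pow_const q
    _ ≤ ∫⁻ _, η ∂ν := by
        refine lintegral_mono_ae ?_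
        rw [hν, ae_withDensity_iff hφm]
        refine ae_of_all _ fun z hz => hη z (hφδ z ?_)
        simpa using hz
    _ = η := by simp

lemma exists_lintegral_translate_sub_rpow_le (hq : 1 ≤ q) (hf : MemLp f (ENNReal.ofReal q))
    {η : ℝ≥0∞} (hη : η ≠ 0) :
    ∃ δ > 0, ∀ z, ‖z‖ < δ → ∫⁻ x, ‖f (x - z) - f x‖ₑ ^ q ≤ η := by
  have hq0 : 0 < q := by linarith
  have : Fact ((1 : ℝ≥0∞) ≤ ENNReal.ofReal q) := ⟨by simpa using hq⟩
  have : Fact (ENNReal.ofReal q ≠ ⊤) := ⟨ENNReal.ofReal_ne_top⟩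
  have hcont : Continuous fun z : EuclideanSpace ℝ (Fin d) =>
      DomAddAct.mk z +ᵥ hf.toLp f := by
    exact (DomAddAct.continuous_mk).vadd continuous_const
  have h0 := hcont.edist (continuous_const (y := hf.toLp f))
  have h1 := h0.tendsto 0
  simp only [DomAddAct.mk_zero, zero_vadd, edist_self] at h1
  have h2 := h1.eventually_le_const (u := η ^ (1 / q))
    (ENNReal.rpow_pos_of_nonneg (pos_iff_ne_zero.2 hη) (by positivity))
  obtain ⟨δ, hδ, h3⟩ := Metric.eventually_nhds_iff.1 h2
  refine ⟨δ, hδ, fun z hz => ?_⟩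
  have h4 := h3 (y := -z) (by simpa using hz)
  rw [DomAddAct.mk_vadd_toLp, Lp.edist_toLp_toLp,
    eLpNorm_eq_lintegral_rpow_enorm_toReal (by simpa using hq0) ENNReal.ofReal_ne_top,
    ENNReal.toReal_ofReal hq0.le, ENNReal.rpow_le_rpow_iff (by positivity)] at h4
  convert h4 using 4 with x
  simp [sub_eq_neg_add]

/-- Functions in `W^{1,q}` are approximated in `W^{1,q}` by bounded Lipschitz functions with
uniform partial derivatives. -/
lemma SobolevPair.exists_uniformC1 (hq : 1 < q)
    {G : EuclideanSpace ℝ (Fin d) → EuclideanSpace ℝ (Fin d)} (hfG : SobolevPair q f G)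
    {η : ℝ≥0∞} (hη : η ≠ 0) :
    ∃ g D, UniformC1 g D ∧ ∫⁻ x, ‖g x - f x‖ₑ ^ q ≤ η ∧
      ∀ j, ∫⁻ x, ‖D j x - G x j‖ₑ ^ q ≤ η := by
  have hq0 : 0 < q := by linarith
  have hlp : ∀ {h : EuclideanSpace ℝ (Fin d) → ℝ}, MemLp h (ENNReal.ofReal q) →
      ∫⁻ x, ‖h x‖ₑ ^ q ≠ ⊤ := fun {h} hh => by
    have := (eLpNorm_lt_top_iff_lintegral_rpow_enorm_lt_top (by simpa using hq0)
      ENNReal.ofReal_ne_top).1 hh.2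
    rw [ENNReal.toReal_ofReal hq0.le] at this
    exact this.ne
  have hGj : ∀ j, MemLp (fun x => G x j) (ENNReal.ofReal q) := fun j =>
    (EuclideanSpace.proj (𝕜 := ℝ) j).comp_memLp' hfG.2.2
  have key : ∀ h : EuclideanSpace ℝ (Fin d) → ℝ, MemLp h (ENNReal.ofReal q) → ∃ δ > 0,
      ∀ φ : ContDiffBump (0 : EuclideanSpace ℝ (Fin d)), φ.rOut ≤ δ →
        ∫⁻ x, ‖smoothing (φ.normed volume) h x - h x‖ₑ ^ q ≤ η := by
    intro h hh
    -- Tonelli needs a measurable representative; the convolution does not see the change.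
    obtain ⟨h', hm', hae⟩ := hh.1.aemeasurable
    have hh' : MemLp h' (ENNReal.ofReal q) := hh.ae_eq hae
    obtain ⟨δ, hδ, H⟩ := exists_lintegral_translate_sub_rpow_le hq.le hh' hη
    refine ⟨δ, hδ, fun φ hφ => ?_⟩
    have h1 := lintegral_smoothing_sub_rpow_le hq φ.continuous_normed φ.hasCompactSupport_normed
      φ.nonneg_normed φ.integral_normed hm' (hh'.locallyIntegrable (by simpa using hq.le))
      (fun z hz => ?_) H
    · rw [smoothing_congr_ae _ hae]
      refine le_trans (le_of_eq (lintegral_congr_ae ?_)) h1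
      filter_upwards [hae] with x hx
      rw [hx]
    · have hz' : z ∈ Function.support (φ.normed volume) := hz
      rw [φ.support_normed_eq, mem_ball_zero_iff] at hz'
      exact hz'.trans_le hφ
  obtain ⟨δ₀, hδ₀, H₀⟩ := key f hfG.2.1
  choose δ hδ H using fun j => key _ (hGj j)
  obtain ⟨r, hr, hr0, hrj⟩ : ∃ r > 0, r ≤ δ₀ ∧ ∀ j, r ≤ δ j := by
    have h1 : ∀ᶠ r : ℝ in 𝓝[>] 0, r ≤ δ₀ ∧ ∀ j, r ≤ δ j :=
      ((eventually_le_nhds hδ₀).and (eventually_all.2 fun j =>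
        eventually_le_nhds (hδ j))).filter_mono nhdsWithin_le_nhds
    obtain ⟨r, hr, h2⟩ := (h1.and self_mem_nhdsWithin).exists
    exact ⟨r, h2, hr⟩
  let φ : ContDiffBump (0 : EuclideanSpace ℝ (Fin d)) := ⟨r / 2, r, by positivity, by linarith⟩
  exact ⟨_, _, uniformC1_smoothing hq.le φ.contDiff_normed φ.hasCompactSupport_normed hfG.1
    (hlp hfG.2.1) (fun j => hlp (hGj j)), H₀ φ hr0, fun j => H j φ (hrj j)⟩

end Smoothing

/-! ### Differences of approximants and countable subadditivity of the capacity. -/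

namespace UniformC1

variable {d : ℕ} {g₁ g₂ : EuclideanSpace ℝ (Fin d) → ℝ}
  {D₁ D₂ : Fin d → EuclideanSpace ℝ (Fin d) → ℝ}

lemma sub (h₁ : UniformC1 g₁ D₁) (h₂ : UniformC1 g₂ D₂) :
    UniformC1 (fun x => g₁ x - g₂ x) fun j x => D₁ j x - D₂ j x := by
  obtain ⟨B₁, hB₁⟩ := h₁.bounded
  obtain ⟨B₂, hB₂⟩ := h₂.bounded
  obtain ⟨L₁, hL₁⟩ := h₁.lipschitz
  obtain ⟨L₂, hL₂⟩ := h₂.lipschitz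
  obtain ⟨K₁, hK₁⟩ := h₁.approx
  obtain ⟨K₂, hK₂⟩ := h₂.approx
  refine ⟨fun j => (h₁.measurable_deriv j).sub (h₂.measurable_deriv j),
    ⟨B₁ + B₂, fun x => (abs_sub _ _).trans (add_le_add (hB₁ x) (hB₂ x))⟩,
    ⟨L₁ + L₂, hL₁.sub hL₂⟩, ⟨K₁ + K₂, fun j x t ht => ?_⟩⟩
  calc _ = |(g₁ (x + t • EuclideanSpace.single j 1) - g₁ x - t * D₁ j x) -
        (g₂ (x + t • EuclideanSpace.single j 1) - g₂ x - t * D₂ j x)| := by congr 1; ring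
    _ ≤ _ := (abs_sub _ _).trans ((add_le_add (hK₁ j x t ht) (hK₂ j x t ht)).trans
        (le_of_eq (by ring)))

lemma const_mul (h : UniformC1 g₁ D₁) (c : ℝ) :
    UniformC1 (fun x => c * g₁ x) fun j x => c * D₁ j x := by
  obtain ⟨B, hB⟩ := h.bounded
  obtain ⟨L, hL⟩ := h.lipschitz
  obtain ⟨K, hK⟩ := h.approx
  refine ⟨fun j => (h.measurable_deriv j).const_mul c, ⟨|c| * B, fun x => ?_⟩,
    ⟨‖c‖₊ * L, (lipschitzWith_smul c).comp hL⟩, ⟨|c| * K, fun j x t ht => ?_⟩⟩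
  · rw [abs_mul]
    exact mul_le_mul_of_nonneg_left (hB x) (abs_nonneg c)
  · calc _ = |c * (g₁ (x + t • EuclideanSpace.single j 1) - g₁ x - t * D₁ j x)| := by
          congr 1; ring
      _ ≤ _ := by
          rw [abs_mul, mul_assoc]
          exact mul_le_mul_of_nonneg_left (hK j x t ht) (abs_nonneg c)

end UniformC1

lemma exists_hasSum_toLp {ι α V : Type*} [MeasurableSpace α] {μ : Measure α}
    [NormedAddCommGroup V] [CompleteSpace V] {P : ℝ≥0∞} [Fact (1 ≤ P)] {v : ι → α → V}
    (hv : ∀ k, MemLp (v k) P μ) (hT : ∑' k, eLpNorm (v k) P μ ≠ ⊤) :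
    ∃ F : Lp V P μ, HasSum (fun k => (hv k).toLp (v k)) F ∧
      eLpNorm F P μ ≤ ∑' k, eLpNorm (v k) P μ := by
  have hnorm : ∀ k, ‖(hv k).toLp (v k)‖ = (eLpNorm (v k) P μ).toReal := fun k => Lp.norm_toLp _ _
  have hs : Summable fun k => ‖(hv k).toLp (v k)‖ := by
    simp only [hnorm]
    exact ENNReal.summable_toReal hT
  refine ⟨_, hs.of_norm.hasSum, ?_⟩
  have h1 := norm_tsum_le_tsum_norm hs
  simp only [hnorm] at h1
  rw [← ENNReal.tsum_toReal_eq fun k => (hv k).2.ne, Lp.norm_def] at h1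
  exact (ENNReal.toReal_le_toReal (Lp.eLpNorm_ne_top _) hT).1 h1

section Sum

variable {d : ℕ} {ι : Type*} {p : ℝ}

/-- Pairing with a fixed $\psi\in L^{p'}$ is continuous on $L^p$. This carries the weak gradient
identity over to a series. -/
lemma hasSum_integral_pairing {V : Type*} [NormedAddCommGroup V] [NormedSpace ℝ V]
    (hp : 1 < p) [Fact (1 ≤ ENNReal.ofReal p)] (B : V →L[ℝ] ℝ →L[ℝ] ℝ)
    {v : ι → EuclideanSpace ℝ (Fin d) → V} (hv : ∀ k, MemLp (v k) (ENNReal.ofReal p))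
    {F : Lp V (ENNReal.ofReal p) (volume : Measure (EuclideanSpace ℝ (Fin d)))}
    (hF : HasSum (fun k => (hv k).toLp (v k)) F) {ψ : EuclideanSpace ℝ (Fin d) → ℝ}
    (hψ : Continuous ψ) (hψc : HasCompactSupport ψ) :
    HasSum (fun k => ∫ x, B (v k x) (ψ x)) (∫ x, B (F x) (ψ x)) := by
  have hpq := Real.HolderConjugate.conjExponent hp
  have hconj : ENNReal.HolderConjugate (ENNReal.ofReal p) (ENNReal.ofReal p.conjExponent) :=
    hpq.ennrealOfReal
  have : Fact (1 ≤ ENNReal.ofReal p.conjExponent) := ⟨by simpa using hpq.symm.lt.le⟩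
  have hψq : MemLp ψ (ENNReal.ofReal p.conjExponent)
      (volume : Measure (EuclideanSpace ℝ (Fin d))) := hψ.memLp_of_hasCompactSupport hψc
  have h1 := hF.mapL ((B.lpPairing volume (ENNReal.ofReal p)
    (ENNReal.ofReal p.conjExponent)).flip (hψq.toLp ψ))
  simp only [ContinuousLinearMap.flip_apply, ContinuousLinearMap.lpPairing_eq_integral] at h1
  have e1 : ∀ k, ∫ x, B ((hv k).toLp (v k) x) (hψq.toLp ψ x) = ∫ x, B (v k x) (ψ x) := by
    intro k
    refine integral_congr_ae ?_
    filter_upwards [(hv k).coeFn_toLp, hψq.coeFn_toLp] with x h2 h3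
    rw [h2, h3]
  have e2 : ∫ x, B (F x) (hψq.toLp ψ x) = ∫ x, B (F x) (ψ x) := by
    refine integral_congr_ae ?_
    filter_upwards [hψq.coeFn_toLp] with x h3
    rw [h3]
  simpa only [e1, e2] using h1

/-- Countable subadditivity of the capacity, in terms of the Sobolev norms of nonnegative test
functions. -/
lemma sobolevCapacity_iUnion_le [Countable ι] (hp : 1 < p)
    {u : ι → EuclideanSpace ℝ (Fin d) → ℝ}
    {G : ι → EuclideanSpace ℝ (Fin d) → EuclideanSpace ℝ (Fin d)}
    (hu : ∀ k, SobolevPair p (u k) (G k)) (hpos : ∀ k x, 0 ≤ u k x)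
    {U : ι → Set (EuclideanSpace ℝ (Fin d))} (hU : ∀ k, IsOpen (U k))
    (hone : ∀ k, ∀ x ∈ U k, 1 ≤ u k x) {T : ℝ≥0∞} (hT : T ≠ ⊤)
    (huT : ∑' k, eLpNorm (u k) (ENNReal.ofReal p) volume ≤ T)
    (hGT : ∑' k, eLpNorm (G k) (ENNReal.ofReal p) volume ≤ T) :
    sobolevCapacity p (⋃ k, U k) ≤ 2 * T ^ p := by
  have hp0 : 0 < p := by linarith
  have hP0 : ENNReal.ofReal p ≠ 0 := by simpa using hp0
  have hP1 : (1 : ℝ≥0∞) ≤ ENNReal.ofReal p := by simpa using hp.le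
  have : Fact (1 ≤ ENNReal.ofReal p) := ⟨hP1⟩
  obtain ⟨F, hF, hFT⟩ := exists_hasSum_toLp (fun k => (hu k).2.1) (ne_top_of_le_ne_top hT huT)
  obtain ⟨Γ, hΓ, hΓT⟩ := exists_hasSum_toLp (fun k => (hu k).2.2) (ne_top_of_le_ne_top hT hGT)
  have hpair : SobolevPair p F Γ := by
    refine ⟨⟨(Lp.memLp F).locallyIntegrable hP1, (Lp.memLp Γ).locallyIntegrable hP1,
      fun φ hφ hφc j => ?_⟩, Lp.memLp F, Lp.memLp Γ⟩
    have h1 := hasSum_integral_pairing hp (ContinuousLinearMap.mul ℝ ℝ) (fun k => (hu k).2.1) hF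
      (ψ := fun x => fderiv ℝ φ x (EuclideanSpace.single j 1))
      ((hφ.continuous_fderiv (by simp)).clm_apply continuous_const)
      ((hφc.fderiv ℝ).comp_left
        (g := fun L : EuclideanSpace ℝ (Fin d) →L[ℝ] ℝ => L (EuclideanSpace.single j 1)) rfl)
    have h2 := hasSum_integral_pairing hp ((ContinuousLinearMap.mul ℝ ℝ).comp
      (EuclideanSpace.proj (𝕜 := ℝ) j)) (fun k => (hu k).2.2) hΓ hφ.continuous hφc
    have h3 : (fun k => ∫ x, u k x * fderiv ℝ φ x (EuclideanSpace.single j 1)) =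
        fun k => -∫ x, G k x j * φ x := funext fun k => (hu k).1.2.2 φ hφ hφc j
    exact h1.unique (show HasSum (fun k => ∫ x, u k x * fderiv ℝ φ x (EuclideanSpace.single j 1)) _
      from h3 ▸ h2.neg)
  -- The sum dominates each term because all terms are nonnegative, so it is at least $1$ almost
  -- everywhere on every `U k`.
  have hle : ∀ᵐ y, ∀ k, u k y ≤ F y := by
    refine ae_all_iff.2 fun k => ?_
    have h1 : (hu k).2.1.toLp (u k) ≤ F := by
      refine le_hasSum hF k fun i _ => ?_
      rw [← Lp.coeFn_nonneg]
      filter_upwards [(hu i).2.1.coeFn_toLp] with x hx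
      rw [hx]
      exact hpos i x
    rw [← Lp.coeFn_le] at h1
    filter_upwards [h1, (hu k).2.1.coeFn_toLp] with x hx hx'
    rwa [hx'] at hx
  have hopen : IsOpen (⋃ k, U k) := isOpen_iUnion hU
  have hF1 : ∀ᵐ y ∂(volume.restrict (⋃ k, U k)), 1 ≤ F y := by
    filter_upwards [ae_restrict_of_ae hle, ae_restrict_mem hopen.measurableSet] with y hy hyU
    obtain ⟨k, hk⟩ := mem_iUnion.1 hyU
    exact (hone k y hk).trans (hy k)
  refine (iInf₂_le_of_le (F : EuclideanSpace ℝ (Fin d) → ℝ)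
    (Γ : EuclideanSpace ℝ (Fin d) → EuclideanSpace ℝ (Fin d))
    (iInf₂_le_of_le hpair ⟨_, hopen, subset_rfl, hF1⟩ le_rfl)).trans ?_
  have hnorm : ∀ {V : Type} [NormedAddCommGroup V] {w : EuclideanSpace ℝ (Fin d) → V},
      eLpNorm w (ENNReal.ofReal p) volume ≤ T → ∫⁻ y, ‖w y‖ₑ ^ p ≤ T ^ p := by
    intro V _ w hw
    rw [eLpNorm_eq_lintegral_rpow_enorm_toReal hP0 ENNReal.ofReal_ne_top,
      ENNReal.toReal_ofReal hp0.le, one_div, ENNReal.rpow_inv_le_iff hp0] at hw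
    exact hw
  rw [lintegral_add_left' ((Lp.aestronglyMeasurable F).enorm.pow_const p), two_mul]
  exact add_le_add (hnorm (hFT.trans huT)) (hnorm (hΓT.trans hGT))

end Sum

/-! ### Approximation off a set of small capacity. -/

section Approximation

variable {d : ℕ} {q : ℝ}

lemma lintegral_const_mul_sub_rpow_le {α : Type*} [MeasurableSpace α] {μ : Measure α}
    (hq : 1 ≤ q) (c : ℝ) {a b f : α → ℝ} (ha : AEMeasurable a μ) (hf : AEMeasurable f μ)
    {η : ℝ≥0∞} (haf : ∫⁻ x, ‖a x - f x‖ₑ ^ q ∂μ ≤ η) (hbf : ∫⁻ x, ‖b x - f x‖ₑ ^ q ∂μ ≤ η) :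
    ∫⁻ x, ‖c * (a x - b x)‖ₑ ^ q ∂μ ≤ ‖c‖ₑ ^ q * 2 ^ (q - 1) * 2 * η := by
  have hq0 : 0 ≤ q := by linarith
  have hc : ‖c‖ₑ ^ q ≠ ⊤ := ENNReal.rpow_ne_top_of_nonneg hq0 enorm_ne_top
  have h2 : (2 : ℝ≥0∞) ^ (q - 1) ≠ ⊤ := ENNReal.rpow_ne_top_of_nonneg (by linarith) (by simp)
  calc ∫⁻ x, ‖c * (a x - b x)‖ₑ ^ q ∂μ
      ≤ ∫⁻ x, ‖c‖ₑ ^ q * 2 ^ (q - 1) * (‖a x - f x‖ₑ ^ q + ‖b x - f x‖ₑ ^ q) ∂μ := by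
        refine lintegral_mono fun x => ?_
        rw [enorm_mul, ENNReal.mul_rpow_of_nonneg _ _ hq0, mul_assoc]
        gcongr
        refine le_trans (ENNReal.rpow_le_rpow ?_ hq0)
          (ENNReal.rpow_add_le_mul_rpow_add_rpow _ _ hq)
        calc ‖a x - b x‖ₑ = ‖(a x - f x) - (b x - f x)‖ₑ := by congr 1; ring
          _ ≤ _ := enorm_sub_le
    _ = ‖c‖ₑ ^ q * 2 ^ (q - 1) * ((∫⁻ x, ‖a x - f x‖ₑ ^ q ∂μ) + ∫⁻ x, ‖b x - f x‖ₑ ^ q ∂μ) := by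
        rw [lintegral_const_mul' _ _ (ENNReal.mul_ne_top hc h2),
          lintegral_add_left' (f := fun x => ‖a x - f x‖ₑ ^ q) ((ha.sub hf).enorm.pow_const q)]
    _ ≤ ‖c‖ₑ ^ q * 2 ^ (q - 1) * (η + η) := by gcongr
    _ = _ := by ring

lemma rectAverage_rpow_le (hq : 1 < q) {a b : Fin d → ℝ} (hab : ∀ j, a j < b j)
    {h : EuclideanSpace ℝ (Fin d) → ℝ≥0∞} (hh : AEMeasurable h) :
    rectAverage a b h ^ q ≤ (volume (openRect a b))⁻¹ * ∫⁻ x, h x ^ q := by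
  have hprob : IsProbabilityMeasure
    ((volume (openRect a b))⁻¹ • volume.restrict (openRect a b)) := by
    constructor
    rw [Measure.smul_apply, Measure.restrict_apply_univ, smul_eq_mul,
      ENNReal.inv_mul_cancel (volume_openRect_ne_zero hab) (volume_openRect_ne_top a b)]
  have h1 := lintegral_rpow_le_lintegral_rpow
    ((volume (openRect a b))⁻¹ • volume.restrict (openRect a b)) hq (hh.restrict.smul_measure _)
  rw [lintegral_smul_measure, lintegral_smul_measure] at h1
  refine h1.trans ?_
  rw [smul_eq_mul]
  gcongr
  exact Measure.restrict_le_self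

lemma rectAverage_enorm_sub_le {a b : Fin d → ℝ} {f g h : EuclideanSpace ℝ (Fin d) → ℝ}
    (hf : AEMeasurable f) (hg : AEMeasurable g) :
    rectAverage a b (fun y => ‖f y - h y‖ₑ) ≤
      rectAverage a b (fun y => ‖f y - g y‖ₑ) + rectAverage a b (fun y => ‖g y - h y‖ₑ) := by
  rw [← rectAverage_add (h := fun y => ‖f y - g y‖ₑ) (hf.sub hg).enorm]
  refine rectAverage_mono fun y => ?_
  calc ‖f y - h y‖ₑ = ‖(f y - g y) + (g y - h y)‖ₑ := by congr 1; ring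
    _ ≤ _ := enorm_add_le _ _

/-- Telescoping: the geometric tail sums to $2\cdot2^{-n}$ and the remainder tends to $0$. -/
lemma le_two_mul_of_le_add_succ {A : ℕ → ℝ≥0∞} (hA : ∀ n, A n ≤ 2⁻¹ ^ n + A (n + 1))
    (hA0 : Tendsto A atTop (𝓝 0)) (n : ℕ) : A n ≤ 2 * 2⁻¹ ^ n := by
  have h1 : ∀ N n, A n ≤ 2 * 2⁻¹ ^ n + A (n + N) := by
    intro N
    induction N with
    | zero => exact fun n => le_add_self
    | succ N ih =>
      intro n
      calc A n ≤ 2⁻¹ ^ n + A (n + 1) := hA n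
        _ ≤ 2⁻¹ ^ n + (2 * 2⁻¹ ^ (n + 1) + A (n + 1 + N)) := by gcongr; exact ih (n + 1)
        _ = (1 + 2 * 2⁻¹) * 2⁻¹ ^ n + A (n + (N + 1)) := by
          rw [show n + 1 + N = n + (N + 1) by ring, pow_succ]; ring
        _ = _ := by
          rw [ENNReal.mul_inv_cancel (by simp) (by simp), one_add_one_eq_two]
  have h2 : Tendsto (fun N => 2 * 2⁻¹ ^ n + A (n + N)) atTop (𝓝 (2 * 2⁻¹ ^ n)) := by
    have := (hA0.comp (tendsto_add_atTop_nat n)).const_add (2 * 2⁻¹ ^ n)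
    rw [add_zero] at this
    simpa only [Function.comp_def, add_comm n] using this
  exact ge_of_tendsto' h2 fun N => h1 N n

/-- A Sobolev function is approximated by bounded Lipschitz functions `g n`, uniformly on average
over the rectangles that meet the complement of an open set `⋃ n, U n` of small capacity. -/
lemma SobolevPair.exists_quasiuniform_approximation {p : ℝ} (hp : 1 < p) (hpq : p ≤ q)
    {f : EuclideanSpace ℝ (Fin d) → ℝ}
    {G : EuclideanSpace ℝ (Fin d) → EuclideanSpace ℝ (Fin d)} (hfG : SobolevPair q f G)
    {ε : ℝ≥0∞} (hε : ε ≠ 0) :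
    ∃ (g : ℕ → EuclideanSpace ℝ (Fin d) → ℝ) (u : ℕ → EuclideanSpace ℝ (Fin d) → ℝ)
      (Γ : ℕ → EuclideanSpace ℝ (Fin d) → EuclideanSpace ℝ (Fin d))
      (U : ℕ → Set (EuclideanSpace ℝ (Fin d))),
      (∀ n, ∃ D, UniformC1 (g n) D) ∧ (∀ n, SobolevPair p (u n) (Γ n)) ∧ (∀ n x, 0 ≤ u n x) ∧
      (∀ n, IsOpen (U n)) ∧ (∀ n, ∀ x ∈ U n, 1 ≤ u n x) ∧
      ∑' n, eLpNorm (u n) (ENNReal.ofReal p) volume ≤ ε ∧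
      ∑' n, eLpNorm (Γ n) (ENNReal.ofReal p) volume ≤ ε ∧
      ∀ x ∉ ⋃ n, U n, ∀ a b : Fin d → ℝ, (∀ j, a j < b j) → x ∈ openRect a b →
        ∀ n, rectAverage a b (fun y => ‖f y - g n y‖ₑ) ≤ 2 * 2⁻¹ ^ n := by
  have hp0 : 0 < p := by linarith
  have hq : 1 < q := by linarith
  have hq0 : 0 < q := by linarith
  obtain ⟨C, hC, H⟩ := exists_sobolevPair_of_uniformC1 d hp hpq
  obtain ⟨δ, hδ, hδε⟩ := ENNReal.exists_pos_sum_of_countable' hε ℕ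
  set K : ℕ → ℝ≥0∞ := fun n => C * ((1 + d) * (‖(2 : ℝ) ^ n‖ₑ ^ q * 2 ^ (q - 1) * 2)) with hK
  have hKtop : ∀ n, K n ≠ ⊤ := fun n => by
    refine ENNReal.mul_ne_top hC (ENNReal.mul_ne_top (by simp) (ENNReal.mul_ne_top
      (ENNReal.mul_ne_top ?_ ?_) (by simp)))
    · exact ENNReal.rpow_ne_top_of_nonneg hq0.le enorm_ne_top
    · exact ENNReal.rpow_ne_top_of_nonneg (by linarith) (by simp)
  -- The first bound makes the norms of the $n$-th test function at most `δ n`; the second forces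
  -- $g_n\to f$ in $L^q$.
  set η' : ℕ → ℝ≥0∞ := fun n => min (δ n ^ p / K n) (2⁻¹ ^ n) with hη'
  have hη'0 : ∀ n, η' n ≠ 0 := fun n => by
    refine (lt_min (ENNReal.div_pos ?_ (hKtop n)) (ENNReal.pow_pos (by simp) n)).ne'
    exact (ENNReal.rpow_pos_of_nonneg (hδ n) hp0.le).ne'
  have hKη : ∀ n, K n * η' n ≤ δ n ^ p := fun n =>
    (mul_le_mul_right (min_le_left _ _) _).trans ENNReal.mul_div_le
  -- The function $g_n$ enters the differences numbered $n$ and $n-1$, so it must meet both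
  -- tolerances. At $n=0$ truncated subtraction repeats the first one.
  have happrox := fun n => hfG.exists_uniformC1 hq (η := min (η' n) (η' (n - 1)))
    (by rw [ne_eq, min_eq_iff]; simp [hη'0])
  choose g D hg hgf hDG using happrox
  have hfm : AEMeasurable f := hfG.2.1.1.aemeasurable
  have hGm : ∀ j, AEMeasurable fun x => G x j := fun j =>
    ((EuclideanSpace.proj (𝕜 := ℝ) j).comp_memLp' hfG.2.2).1.aemeasurable
  have hh := fun n => ((hg (n + 1)).sub (hg n)).const_mul (2 ^ n)
  have hhq : ∀ n, ∫⁻ x, ‖2 ^ n * (g (n + 1) x - g n x)‖ₑ ^ q ≤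
      ‖(2 : ℝ) ^ n‖ₑ ^ q * 2 ^ (q - 1) * 2 * η' n := fun n =>
    lintegral_const_mul_sub_rpow_le hq.le _ (hg (n + 1)).measurable.aemeasurable hfm
      ((hgf (n + 1)).trans (min_le_right _ _)) ((hgf n).trans (min_le_left _ _))
  have hDq : ∀ n j, ∫⁻ x, ‖2 ^ n * (D (n + 1) j x - D n j x)‖ₑ ^ q ≤
      ‖(2 : ℝ) ^ n‖ₑ ^ q * 2 ^ (q - 1) * 2 * η' n := fun n j =>
    lintegral_const_mul_sub_rpow_le hq.le _ ((hg (n + 1)).measurable_deriv j).aemeasurable (hGm j)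
      ((hDG (n + 1) j).trans (min_le_right _ _)) ((hDG n j).trans (min_le_left _ _))
  have hfin : ∀ n, ‖(2 : ℝ) ^ n‖ₑ ^ q * 2 ^ (q - 1) * 2 * η' n ≠ ⊤ := fun n => by
    refine ENNReal.mul_ne_top (ENNReal.mul_ne_top (ENNReal.mul_ne_top ?_ ?_) (by simp)) ?_
    · exact ENNReal.rpow_ne_top_of_nonneg hq0.le enorm_ne_top
    · exact ENNReal.rpow_ne_top_of_nonneg (by linarith) (by simp)
    · exact ne_top_of_le_ne_top (ENNReal.pow_ne_top (by simp)) (min_le_right _ _)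
  have hsum : ∀ n, C * ((∫⁻ x, ‖2 ^ n * (g (n + 1) x - g n x)‖ₑ ^ q) +
      ∑ j, ∫⁻ x, ‖2 ^ n * (D (n + 1) j x - D n j x)‖ₑ ^ q) ≤ δ n ^ p := fun n => by
    refine le_trans ?_ (hKη n)
    calc _ ≤ C * ((‖(2 : ℝ) ^ n‖ₑ ^ q * 2 ^ (q - 1) * 2 * η' n) +
          ∑ _j : Fin d, (‖(2 : ℝ) ^ n‖ₑ ^ q * 2 ^ (q - 1) * 2 * η' n)) := by
          gcongr with j
          · exact hhq n
          · exact hDq n j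
      _ = _ := by
          simp only [Finset.sum_const, Finset.card_univ, Fintype.card_fin, nsmul_eq_mul, hK]
          ring
  choose u Γ huΓ hupos huone hopen hun hΓn using fun n => H _ _ (hh n)
    (ne_top_of_le_ne_top (hfin n) (hhq n)) (fun j => ne_top_of_le_ne_top (hfin n) (hDq n j))
  have hnorm : ∀ {V : Type} [NormedAddCommGroup V] {w : EuclideanSpace ℝ (Fin d) → V} {n : ℕ},
      ∫⁻ y, ‖w y‖ₑ ^ p ≤ δ n ^ p → eLpNorm w (ENNReal.ofReal p) volume ≤ δ n := by
    intro V _ w n hw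
    rwa [eLpNorm_eq_lintegral_rpow_enorm_toReal (by simpa using hp0) ENNReal.ofReal_ne_top,
      ENNReal.toReal_ofReal hp0.le, one_div, ENNReal.rpow_inv_le_iff hp0]
  refine ⟨g, u, Γ, _, fun n => ⟨_, hg n⟩, huΓ, hupos, hopen, fun n x hx => huone n x hx,
    (ENNReal.tsum_le_tsum fun n => hnorm ((hun n).trans (hsum n))).trans hδε.le,
    (ENNReal.tsum_le_tsum fun n => hnorm ((hΓn n).trans (hsum n))).trans hδε.le, ?_⟩
  intro x hx a b hab hxab
  refine le_two_mul_of_le_add_succ (fun n => ?_) ?_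
  -- Outside $U_n$ the maximal function of $2^n(g_{n+1}-g_n)$ is at most $1$.
  · have h1 : rectAverage a b (fun y => ‖2 ^ n * (g (n + 1) y - g n y)‖ₑ) ≤ 1 := by
      refine (rectAverage_le_rectMaximal hab hxab _).trans ?_
      by_contra! hcon
      exact hx (mem_iUnion.2 ⟨n, hcon⟩)
    simp only [enorm_mul] at h1
    rw [rectAverage_const_mul a b enorm_ne_top] at h1
    have h2 : rectAverage a b (fun y => ‖g (n + 1) y - g n y‖ₑ) ≤ 2⁻¹ ^ n := by
      rw [← ENNReal.inv_pow, ENNReal.le_inv_iff_mul_le, mul_comm]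
      convert h1 using 2
      rw [enorm_pow, Real.enorm_eq_ofReal (by norm_num), ENNReal.ofReal_ofNat]
    calc _ ≤ _ := rectAverage_enorm_sub_le (g := g (n + 1)) hfm (hg (n + 1)).measurable.aemeasurable
      _ ≤ _ := by rw [add_comm]; gcongr
  -- For a fixed rectangle, Jensen and $L^q$ convergence make the averages tend to $0$. The rate
  -- depends on the rectangle, but only the limit is needed.
  · have h1 : ∀ n, rectAverage a b (fun y => ‖f y - g n y‖ₑ) ≤
        ((volume (openRect a b))⁻¹ * 2⁻¹ ^ n) ^ q⁻¹ := by
      intro n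
      rw [ENNReal.le_rpow_inv_iff hq0]
      refine (rectAverage_rpow_le hq hab (hfm.sub (hg n).measurable.aemeasurable).enorm).trans ?_
      gcongr
      refine (lintegral_congr fun y => by rw [Pi.sub_apply, enorm_sub_rev]).trans_le ?_
      exact (hgf n).trans ((min_le_left _ _).trans (min_le_right _ _))
    refine tendsto_of_tendsto_of_tendsto_of_le_of_le tendsto_const_nhds ?_ (fun _ => zero_le) h1
    have h2 : Tendsto (fun n : ℕ => (volume (openRect a b))⁻¹ * (2⁻¹ : ℝ≥0∞) ^ n) atTop (𝓝 0) := by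
      have := ENNReal.Tendsto.const_mul (a := (volume (openRect a b))⁻¹)
        (ENNReal.tendsto_pow_atTop_nhds_zero_of_lt_one (r := 2⁻¹) (by simp))
        (Or.inr (by simpa using volume_openRect_ne_zero hab))
      simpa using this
    have h3 := (ENNReal.continuous_rpow_const (y := q⁻¹)).tendsto 0 |>.comp h2
    rwa [ENNReal.zero_rpow_of_pos (by positivity)] at h3

end Approximation

/-! ### Continuity off the exceptional set. -/

lemma prod_add_le_prod_add {ι : Type*} (s : Finset ι) {b : ι → ℝ≥0∞} {Λ η : ℝ≥0∞} (hη : η ≤ 1)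
    (hb : ∀ i, b i ≤ Λ) :
    ∏ i ∈ s, (b i + η) ≤ ∏ i ∈ s, b i + η * (s.card * (Λ + 1) ^ s.card) := by
  classical
  induction s using Finset.induction_on with
  | empty => simp
  | insert i s hi ih =>
    rw [Finset.prod_insert hi, Finset.prod_insert hi, Finset.card_insert_of_notMem hi]
    have h1 : ∏ i ∈ s, (b i + η) ≤ (Λ + 1) ^ s.card :=
      Finset.prod_le_pow_card _ _ _ fun i _ => add_le_add (hb i) hη
    calc (b i + η) * ∏ i ∈ s, (b i + η) = b i * ∏ i ∈ s, (b i + η) + η * ∏ i ∈ s, (b i + η) := by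
          ring
      _ ≤ b i * (∏ i ∈ s, b i + η * (s.card * (Λ + 1) ^ s.card)) + η * (Λ + 1) ^ s.card := by
          gcongr
      _ = b i * ∏ i ∈ s, b i + η * (s.card * (b i * (Λ + 1) ^ s.card) + (Λ + 1) ^ s.card) := by
          ring
      _ ≤ b i * ∏ i ∈ s, b i + η * (s.card * ((Λ + 1) * (Λ + 1) ^ s.card) +
            (Λ + 1) * (Λ + 1) ^ s.card) := by
          gcongr
          · exact (hb i).trans le_self_add
          · exact le_mul_of_one_le_left zero_le le_add_self
      _ = _ := by push_cast; ring

/-- The tolerance is the same for all families bounded by $\Lambda$, hence for all rectangles at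
once. -/
lemma exists_prod_le_prod_add {ι : Type*} [Fintype ι] {Λ δ : ℝ≥0∞} (hΛ : Λ ≠ ⊤) (hδ : δ ≠ 0) :
    ∃ η : ℝ≥0∞, η ≠ 0 ∧ ∀ a b : ι → ℝ≥0∞, (∀ i, b i ≤ Λ) → (∀ i, a i ≤ b i + η) →
      ∏ i, a i ≤ ∏ i, b i + δ := by
  set c : ℝ≥0∞ := (Finset.univ : Finset ι).card * (Λ + 1) ^ (Finset.univ : Finset ι).card with hc
  have hctop : c ≠ ⊤ := ENNReal.mul_ne_top (by simp) (ENNReal.pow_ne_top (by simp [hΛ]))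
  refine ⟨min 1 (δ / c), (lt_min one_pos (ENNReal.div_pos hδ hctop)).ne', fun a b hb hab => ?_⟩
  calc ∏ i, a i ≤ ∏ i, (b i + min 1 (δ / c)) := Finset.prod_le_prod' fun i _ => hab i
    _ ≤ ∏ i, b i + min 1 (δ / c) * c := prod_add_le_prod_add _ (min_le_left _ _) hb
    _ ≤ ∏ i, b i + δ / c * c := by gcongr; exact min_le_right _ _
    _ ≤ _ := by rw [mul_comm]; gcongr; exact ENNReal.mul_div_le

section Continuity

variable {d m : ℕ}

/-- Pass from $f$ to $g$ on the rectangle, translate $g$ at cost $L|w|$, and return to $f$ on the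
translate. -/
lemma rectAverage_le_translate_of_approx {f g : EuclideanSpace ℝ (Fin d) → ℝ} (hf : AEMeasurable f)
    {L : ℝ≥0} (hg : LipschitzWith L g) {κ : ℝ≥0∞} {a b : Fin d → ℝ} (hab : ∀ j, a j < b j)
    (w : EuclideanSpace ℝ (Fin d)) (h₁ : rectAverage a b (fun y => ‖f y - g y‖ₑ) ≤ κ)
    (h₂ : rectAverage (fun j => a j + w j) (fun j => b j + w j) (fun y => ‖f y - g y‖ₑ) ≤ κ) :
    rectAverage a b (fun y => ‖f y‖ₑ) ≤
      rectAverage (fun j => a j + w j) (fun j => b j + w j) (fun y => ‖f y‖ₑ) +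
        (2 * κ + L * ‖w‖ₑ) := by
  have hgm : AEMeasurable g := hg.continuous.aemeasurable
  have e1 : rectAverage a b (fun y => ‖f y‖ₑ) ≤
      rectAverage a b (fun y => ‖f y - g y‖ₑ) + rectAverage a b (fun y => ‖g y‖ₑ) := by
    simpa using rectAverage_enorm_sub_le (a := a) (b := b) (h := 0) hf hgm
  have e2 : rectAverage a b (fun y => ‖g y‖ₑ) ≤
      L * ‖w‖ₑ + rectAverage (fun j => a j + w j) (fun j => b j + w j) (fun y => ‖g y‖ₑ) := by
    rw [rectAverage_translate]
    have h := rectAverage_enorm_sub_le (a := a) (b := b) (h := 0) hgm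
      (g := fun y => g (y + w)) (hg.continuous.comp (continuous_add_const w)).aemeasurable
    simp only [Pi.zero_apply, sub_zero] at h
    refine h.trans (add_le_add ?_ le_rfl)
    refine (rectAverage_mono fun y => ?_).trans (rectAverage_const hab _).le
    have := hg.edist_le_mul y (y + w)
    simpa [edist_eq_enorm_sub] using this
  have e3 : rectAverage (fun j => a j + w j) (fun j => b j + w j) (fun y => ‖g y‖ₑ) ≤
      rectAverage (fun j => a j + w j) (fun j => b j + w j) (fun y => ‖f y - g y‖ₑ) +
      rectAverage (fun j => a j + w j) (fun j => b j + w j) (fun y => ‖f y‖ₑ) := by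
    have := rectAverage_enorm_sub_le (a := fun j => a j + w j) (b := fun j => b j + w j)
      (h := 0) hgm hf
    simpa [enorm_sub_rev (g _)] using this
  calc rectAverage a b (fun y => ‖f y‖ₑ)
      ≤ κ + (L * ‖w‖ₑ + (κ + rectAverage (fun j => a j + w j) (fun j => b j + w j)
          (fun y => ‖f y‖ₑ))) := by
        refine e1.trans (add_le_add h₁ (e2.trans (add_le_add_right (e3.trans ?_) _)))
        gcongr
    _ = _ := by ring

lemma strongMaximal_ne_top_and_continuousOn {f : Fin m → EuclideanSpace ℝ (Fin d) → ℝ}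
    (hf : ∀ i, AEMeasurable (f i)) {g : Fin m → ℕ → EuclideanSpace ℝ (Fin d) → ℝ}
    (hg : ∀ i n, ∃ D, UniformC1 (g i n) D) {S : Set (EuclideanSpace ℝ (Fin d))}
    (hS : ∀ i, ∀ x ∈ S, ∀ a b : Fin d → ℝ, (∀ j, a j < b j) → x ∈ openRect a b →
      ∀ n, rectAverage a b (fun y => ‖f i y - g i n y‖ₑ) ≤ 2 * 2⁻¹ ^ n) :
    (∀ x ∈ S, strongMaximal f x ≠ ⊤) ∧ ContinuousOn (strongMaximal f) S := by
  -- The bound comes from the approximants with index $0$: error at most $2$, plus the supremum of a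
  -- bounded function.
  obtain ⟨Λ, hΛ, hfΛ⟩ : ∃ Λ : ℝ≥0∞, Λ ≠ ⊤ ∧ ∀ i, ∀ x ∈ S, ∀ a b : Fin d → ℝ, (∀ j, a j < b j) →
      x ∈ openRect a b → rectAverage a b (fun y => ‖f i y‖ₑ) ≤ Λ := by
    choose D hD using fun i => hg i 0
    choose B hB using fun i => (hD i).bounded
    refine ⟨2 + ∑ i, ENNReal.ofReal (B i), by simp, ?_⟩
    intro i x hx a b hab hxab
    have h1 := rectAverage_enorm_sub_le (a := a) (b := b) (h := 0) (hf i)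
      (hD i).measurable.aemeasurable
    simp only [Pi.zero_apply, sub_zero] at h1
    refine h1.trans (add_le_add (by simpa using hS i x hx a b hab hxab 0) ?_)
    refine le_trans ?_ (Finset.single_le_sum (f := fun i => ENNReal.ofReal (B i))
      (fun _ _ => zero_le) (Finset.mem_univ i))
    refine (rectAverage_mono fun y => ?_).trans (rectAverage_const hab _).le
    rw [Real.enorm_eq_ofReal_abs]
    exact ENNReal.ofReal_le_ofReal (hB i y)
  have hfin : ∀ x ∈ S, strongMaximal f x ≠ ⊤ := by
    intro x hx
    refine ne_top_of_le_ne_top (ENNReal.pow_ne_top hΛ (n := m))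
      (iSup₂_le fun a b => iSup₂_le fun hab hxab => ?_)
    calc _ ≤ ∏ _i : Fin m, Λ := Finset.prod_le_prod' fun i _ => hfΛ i x hx a b hab hxab
      _ = Λ ^ m := by simp
  refine ⟨hfin, ?_⟩
  have hunif : ∀ δ : ℝ≥0∞, δ ≠ 0 → ∃ ρ : ℝ≥0∞, 0 < ρ ∧ ∀ x ∈ S, ∀ x' ∈ S, edist x' x < ρ →
      strongMaximal f x ≤ strongMaximal f x' + δ := by
    intro δ hδ
    obtain ⟨η, hη, H⟩ := exists_prod_le_prod_add (ι := Fin m) hΛ hδ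
    obtain ⟨n, hn⟩ : ∃ n : ℕ, 2 * (2 * 2⁻¹ ^ n) ≤ η / 2 := by
      have h1 : Tendsto (fun n : ℕ => 2 * (2 * (2⁻¹ : ℝ≥0∞) ^ n)) atTop (𝓝 0) := by
        have := ENNReal.Tendsto.const_mul (a := 2) (ENNReal.Tendsto.const_mul (a := 2)
          (ENNReal.tendsto_pow_atTop_nhds_zero_of_lt_one (r := 2⁻¹) (by simp))
          (Or.inr (by simp))) (Or.inr (by simp))
        simpa using this
      exact (h1.eventually_le_const (ENNReal.half_pos hη)).exists
    choose D hD using fun i => hg i n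
    choose L hL using fun i => (hD i).lipschitz
    have hLtop : (∑ i, (L i : ℝ≥0∞)) ≠ ⊤ := by simp
    -- Half of $\eta$ pays for the two approximation errors, half for the Lipschitz term. If all
    -- constants vanish, the quotient is $\infty$, which is harmless.
    refine ⟨η / 2 / ∑ i, (L i : ℝ≥0∞), ENNReal.div_pos (ENNReal.half_pos hη).ne' hLtop,
      fun x hx x' hx' hxx' => ?_⟩
    refine iSup₂_le fun a b => iSup₂_le fun hab hxab => ?_
    set w := x' - x with hw
    have hab' : ∀ j, a j + w j < b j + w j := fun j => by simpa using hab j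
    have hxab' : x' ∈ openRect (fun j => a j + w j) (fun j => b j + w j) := by
      have := (mem_openRect_add (x := x) w).2 hxab
      rwa [hw, add_sub_cancel] at this
    refine le_trans (H _ (fun i => rectAverage (fun j => a j + w j) (fun j => b j + w j)
      (fun y => ‖f i y‖ₑ)) (fun i => hfΛ i x' hx' _ _ hab' hxab') fun i => ?_) ?_
    · refine (rectAverage_le_translate_of_approx (hf i) (hL i) hab w
        (hS i x hx a b hab hxab n) (hS i x' hx' _ _ hab' hxab' n)).trans ?_
      refine add_le_add_right ?_ _
      calc 2 * (2 * 2⁻¹ ^ n) + L i * ‖w‖ₑ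
          ≤ η / 2 + (∑ i, (L i : ℝ≥0∞)) * (η / 2 / ∑ i, (L i : ℝ≥0∞)) := by
            gcongr
            · exact Finset.single_le_sum (f := fun i => (L i : ℝ≥0∞))
                (fun _ _ => zero_le) (Finset.mem_univ i)
            · rw [hw, ← edist_eq_enorm_sub]
              exact hxx'.le
        _ ≤ η / 2 + η / 2 := by gcongr; exact ENNReal.mul_div_le
        _ = η := ENNReal.add_halves η
    · gcongr
      exact le_iSup₂_of_le (fun j => a j + w j) (fun j => b j + w j)
        (le_iSup₂_of_le hab' hxab' le_rfl)
  intro x hx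
  refine (ENNReal.tendsto_nhds (hfin x hx)).2 fun δ hδ => ?_
  obtain ⟨ρ, hρ, H⟩ := hunif δ hδ.ne'
  filter_upwards [self_mem_nhdsWithin, mem_nhdsWithin_of_mem_nhds (Metric.eball_mem_nhds x hρ)]
    with x' hx' hxx'
  -- The one-sided estimate, used with the points in both orders, gives the two-sided one.
  refine ⟨tsub_le_iff_right.2 (H x hx x' hx' hxx'), H x' hx' x hx ?_⟩
  rw [edist_comm]
  exact hxx'

end Continuity

theorem theorem1p5 {d m : ℕ} (hd : 1 ≤ d) (p : ℝ) (q : Fin m → ℝ)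
    (hp : 1 < p) (hq : ∀ i, 1 < q i) (hpq : 1 / p = ∑ i, 1 / q i)
    (f : Fin m → EuclideanSpace ℝ (Fin d) → ℝ) (hf : ∀ i, MemSobolev (q i) (f i)) :
    IsQuasicontinuous p (strongMaximal f) := by
  intro ε hε
  have hp0 : 0 < p := by linarith
  have hpq' : ∀ i, p ≤ q i := fun i => by
    have hqi : ∀ i, 0 < q i := fun i => one_pos.trans (hq i)
    rw [← one_div_le_one_div (hqi i) hp0, hpq]
    exact Finset.single_le_sum (f := fun i => 1 / q i)
      (fun i _ => (one_div_pos.2 (hqi i)).le) (Finset.mem_univ i)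
  obtain ⟨T, hT0, hT, hTε⟩ : ∃ T : ℝ≥0∞, T ≠ 0 ∧ T ≠ ⊤ ∧ 2 * T ^ p < ε := by
    obtain ⟨r, hr0, hr⟩ := ENNReal.lt_iff_exists_nnreal_btwn.1 (ENNReal.half_pos hε.ne')
    refine ⟨(r : ℝ≥0∞) ^ p⁻¹, (ENNReal.rpow_pos hr0 ENNReal.coe_ne_top).ne',
      ENNReal.rpow_ne_top_of_nonneg (by positivity) ENNReal.coe_ne_top, ?_⟩
    rw [← ENNReal.rpow_mul, inv_mul_cancel₀ hp0.ne', ENNReal.rpow_one, mul_comm]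
    exact (ENNReal.lt_div_iff_mul_lt (.inl (by simp)) (.inl (by simp))).1 hr
  choose G hG using hf
  -- Each of the $m$ functions receives the budget $T/m$, so the norms summed over all pairs $(i,n)$
  -- stay within $T$.
  have hTm : T / m ≠ 0 := (ENNReal.div_pos hT0 (by simp)).ne'
  choose g u Γ U hgC huΓ hupos hUopen huone huT hΓT happ using fun i =>
    (hG i).exists_quasiuniform_approximation hp (hpq' i) hTm
  have hsum : ∀ v : Fin m × ℕ → ℝ≥0∞, (∀ i, ∑' n, v (i, n) ≤ T / m) → ∑' k, v k ≤ T := by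
    intro v hv
    rw [ENNReal.tsum_prod', tsum_fintype]
    calc _ ≤ ∑ _i : Fin m, T / m := Finset.sum_le_sum fun i _ => hv i
      _ = m * (T / m) := by simp
      _ ≤ T := ENNReal.mul_div_le
  have hcap := sobolevCapacity_iUnion_le (ι := Fin m × ℕ) hp (u := fun k => u k.1 k.2)
    (G := fun k => Γ k.1 k.2) (U := fun k => U k.1 k.2) (fun k => huΓ k.1 k.2)
    (fun k => hupos k.1 k.2) (fun k => hUopen k.1 k.2) (fun k => huone k.1 k.2) hT
    (hsum _ huT) (hsum _ hΓT)
  have hmain := strongMaximal_ne_top_and_continuousOn (S := (⋃ k : Fin m × ℕ, U k.1 k.2)ᶜ)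
    (fun i => (hG i).2.1.1.aemeasurable) hgC (fun i x hx => happ i x fun hxU => hx (by
      obtain ⟨n, hn⟩ := mem_iUnion.1 hxU
      exact mem_iUnion.2 ⟨(i, n), hn⟩))
  exact ⟨_, hcap.trans_lt hTε, hmain.2, hmain.1⟩
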